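/- Let $G$ be a finite simple graph that is planar (it can be drawn in the plane with distinct points as vertices and polygonal arcs as edges, so that an edge contains no vertices other than its two ends and two edges meet only in common ends). Suppose that no $4$-cycle of $G$ is adjacent to a $3$-cycle of $G$, i.e. no (not necessarily induced) cycle of length $4$ in $G$ shares an edge with a cycle of length $3$ in $G$. Then $G$ is signed $4$-choosable: for every signature $\sigma : E(G) \to \{1,-1\}$ and every assignment to each vertex $v$ of a set $L(v) \subseteq \mathbb{Z}$ with $|L(v)| \ge 4$, there is a map $f : V(G) \to \mathbb{Z}$ such that $f(v) \in L(v)$ for every $v \in V(G)$ and $f(u) \ne \sigma(uv)\, f(v)$ for every edge $uv \in E(G)$. -/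

import Mathlib

/-- `A` is a polygonal arc in the plane with endpoints `p` and `q`: the union of finitely many
(at least one) nondegenerate straight line segments `[x 0, x 1], …, [x (n-1), x n]` with `x 0 = p`
and `x n = q`, where two consecutive segments meet only in their common endpoint and
non-consecutive segments are disjoint. -/
def IsPolygonalArc (A : Set (ℝ × ℝ)) (p q : ℝ × ℝ) : Prop :=
  ∃ (n : ℕ) (x : ℕ → ℝ × ℝ), 1 ≤ n ∧ x 0 = p ∧ x n = q ∧
    (∀ i < n, x i ≠ x (i + 1)) ∧
    (∀ i j, i < j → j < n → ∀ z ∈ segment ℝ (x i) (x (i + 1)),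
      z ∈ segment ℝ (x j) (x (j + 1)) → j = i + 1 ∧ z = x j) ∧
    A = ⋃ i ∈ Set.Iio n, segment ℝ (x i) (x (i + 1))

/-- A drawing of the graph `G` in the plane without crossings: the vertices are drawn as distinct
points, every edge is drawn as a polygonal arc joining its two ends, an arc contains no vertex
other than its ends, and the arcs of two distinct edges meet only in common ends. -/
structure PlaneDrawing {V : Type*} (G : SimpleGraph V) where
  pos : V → ℝ × ℝ
  arc : Sym2 V → Set (ℝ × ℝ)
  pos_injective : Function.Injective pos
  isPolygonalArc_arc : ∀ u v, G.Adj u v → IsPolygonalArc (arc s(u, v)) (pos u) (pos v)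
  mem_of_pos_mem_arc : ∀ e ∈ G.edgeSet, ∀ w, pos w ∈ arc e → w ∈ e
  arc_inter_arc : ∀ e ∈ G.edgeSet, ∀ e' ∈ G.edgeSet, e ≠ e' → ∀ z ∈ arc e, z ∈ arc e' →
    ∃ w, w ∈ e ∧ w ∈ e' ∧ z = pos w

/-- A graph is planar if it can be drawn in the plane without crossings. -/
def IsPlanar {V : Type*} (G : SimpleGraph V) : Prop :=
  Nonempty (PlaneDrawing G)

/-- No 4-cycle of `G` is adjacent to a 3-cycle of `G`, that is, no 4-cycle shares an edge with a
3-cycle (the cycles need not be induced). -/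
def NoFourCycleAdjacentToTriangle {V : Type*} (G : SimpleGraph V) : Prop :=
  ∀ (x : V) (c : G.Walk x x) (y : V) (t : G.Walk y y),
    c.IsCycle → c.length = 4 → t.IsCycle → t.length = 3 → ∀ e ∈ c.edges, e ∉ t.edges

/-- A signature of `G`: a sign `1` or `-1` for each edge. The pair `(G, σ)` is a signed graph. -/
abbrev Signature {V : Type*} (G : SimpleGraph V) : Type _ :=
  G.edgeSet → ℤˣ

/-- `f` is a (proper) coloring of the signed graph `(G, σ)`: `f u ≠ σ(uv) f v` for each edge. -/
def IsSignedColoring {V : Type*} (G : SimpleGraph V) (σ : Signature G) (f : V → ℤ) : Prop :=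
  ∀ (u v : V) (h : G.Adj u v), f u ≠ (σ ⟨s(u, v), h⟩ : ℤ) * f v

/-- The signed graph `(G, σ)` is `k`-choosable: whenever every vertex gets a list of at least `k`
integers, there is a coloring of `(G, σ)` that takes the color of each vertex from its list. -/
def IsSignedGraphChoosable {V : Type*} (G : SimpleGraph V) (σ : Signature G) (k : ℕ) : Prop :=
  ∀ L : V → Set ℤ, (∀ v, (k : ℕ∞) ≤ (L v).encard) →
    ∃ f : V → ℤ, (∀ v, f v ∈ L v) ∧ IsSignedColoring G σ f

/-- `G` is signed `k`-choosable: `(G, σ)` is `k`-choosable for every signature `σ`. -/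
def IsSignedChoosable {V : Type*} (G : SimpleGraph V) (k : ℕ) : Prop :=
  ∀ σ : Signature G, IsSignedGraphChoosable G σ k

/-! The proof finds a reducible configuration by discharging, after deriving Euler's inequality from
the drawing by parity arguments.

Reducibility (`IsPartialColoring.exists_extend`). Colour vertex sets `S` by strong induction. A
vertex with at most 3 neighbours in `S` is coloured last. Otherwise `S` induces minimum degree at
least 4, and a light pair occurs: a 5-cycle `a b c d e` and a triangle `a b x`, all of degree 4.
Remove the six vertices and colour the rest. Then `x` keeps two admissible colours, and `a` can be
given a colour that conflicts with neither. Colouring `e, d, c, b` in this order, each still has an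
uncoloured neighbour, hence at most three conflicts. Finally `b` spoils at most one of the two
colours of `x`. Signs only permute colours along an edge, so counting conflicts is unaffected.

Existence of a light pair (`IsPlanar.exists_lightPair`). Give every dart the charges `1 - 4 / deg`
at its vertex and `1 - 4 / len` at its face. The total is `4E - 4V - 4F`, at most `-8` by Euler.
Each triangle receives 1/3 through each edge; as no face of length 3 or 4 is next to a triangle,
only pentagons with at least four triangular edges get into debt. Their vertices of degree at least
5 pay 1/3 per incident triangular edge if there is only one such vertex, and 1/6 otherwise. If there
is none, the apex of each triangle whose two neighbouring edges on the pentagon are also triangular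
pays 1/6; without light pairs this apex has degree at least 5. No charge ends up negative in total
(`CombinatorialMap.Reduced.sum_charge_nonneg`), a contradiction.

Euler's inequality (`euler_inequality`). Modulo 2, the number of edges of an even edge set above a
point tells on which side of the set the point lies. Evaluated to the left of each dart, this parity
is constant along faces of the rotation system, and the values on the two sides of an edge add up to
its weight. So every even edge set is a sum of face boundaries, and comparing dimensions gives `E -
(V - 1) ≤ F - 1`. Connectedness is not needed for the inequality. -/

/-! ### Parity of the number of segments above a segment -/

/-- Finitely many non-vertical straight segments in the plane, directed from left to right, whose
end points have distinct first coordinates and which meet only in common end points. -/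
structure SegmentSystem (I : Type*) where
  l : I → ℝ × ℝ
  r : I → ℝ × ℝ
  lt : ∀ i, (l i).1 < (r i).1
  left_left : ∀ i j, (l i).1 = (l j).1 → l i = l j
  left_right : ∀ i j, (l i).1 = (r j).1 → l i = r j
  right_right : ∀ i j, (r i).1 = (r j).1 → r i = r j
  cross : ∀ i j, i ≠ j → ∀ z ∈ segment ℝ (l i) (r i), z ∈ segment ℝ (l j) (r j) →
    z = l i ∨ z = r i

namespace SegmentSystem

variable {I : Type*} (S : SegmentSystem I)

/-- The slope of a segment. -/
noncomputable def slope (i : I) : ℝ := ((S.r i).2 - (S.l i).2) / ((S.r i).1 - (S.l i).1)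

/-- The height at `x` of the line that carries a segment. -/
noncomputable def line (i : I) (x : ℝ) : ℝ := (S.l i).2 + S.slope i * (x - (S.l i).1)

lemma line_left (i : I) : S.line i (S.l i).1 = (S.l i).2 := by simp [line]

lemma line_right (i : I) : S.line i (S.r i).1 = (S.r i).2 := by
  have := S.lt i
  have h : (S.r i).1 - (S.l i).1 ≠ 0 := by linarith
  simp only [line, slope]
  field_simp
  ring

lemma line_sub (i : I) (x y : ℝ) : S.line i x - S.line i y = S.slope i * (x - y) := by
  simp only [line]; ring

lemma mem_segment (i : I) {x : ℝ} (h1 : (S.l i).1 ≤ x) (h2 : x ≤ (S.r i).1) :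
    (x, S.line i x) ∈ segment ℝ (S.l i) (S.r i) := by
  have := S.lt i
  have h : (S.r i).1 - (S.l i).1 > 0 := by linarith
  rw [segment_eq_image']
  refine ⟨(x - (S.l i).1) / ((S.r i).1 - (S.l i).1), ⟨by apply div_nonneg <;> linarith, ?_⟩, ?_⟩
  · rw [div_le_one h]; linarith
  · ext
    · simp; field_simp; ring
    · simp [line, slope]; field_simp

lemma line_ne {i j : I} (hij : i ≠ j) {x : ℝ} (h1 : (S.l i).1 < x) (h2 : x < (S.r i).1)
    (h3 : (S.l j).1 ≤ x) (h4 : x ≤ (S.r j).1) : S.line i x ≠ S.line j x := by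
  intro h
  have hi := S.mem_segment i h1.le h2.le
  have hj := S.mem_segment j h3 h4
  rw [← h] at hj
  rcases S.cross i j hij _ hi hj with h' | h' <;>
    · have := congrArg Prod.fst h'
      simp only at this
      linarith

/-- Intermediate value theorem: a change of order would force a crossing strictly inside both
segments. Only `≤` survives, since `x'` may belong to a common end point. -/
lemma line_le {i j : I} (hij : i ≠ j) {x x' : ℝ}
    (h1 : (S.l i).1 ≤ x) (h2 : x ≤ (S.r i).1) (h3 : (S.l j).1 ≤ x) (h4 : x ≤ (S.r j).1)
    (h1' : (S.l i).1 ≤ x') (h2' : x' ≤ (S.r i).1) (h3' : (S.l j).1 ≤ x') (h4' : x' ≤ (S.r j).1)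
    (h : S.line i x < S.line j x) : S.line i x' ≤ S.line j x' := by
  by_contra! hlt
  have hc : ContinuousOn (fun t => S.line j t - S.line i t) (Set.uIcc x x') := by
    unfold line; fun_prop
  obtain ⟨t, ht, ht0⟩ := intermediate_value_uIcc hc
    (show (0 : ℝ) ∈ Set.uIcc _ _ from Set.mem_uIcc.2 (Or.inr ⟨by linarith, by linarith⟩))
  have htx : t ≠ x := by rintro rfl; simp only at ht0; linarith
  have htx' : t ≠ x' := by rintro rfl; simp only at ht0; linarith
  have h0 : S.line i t = S.line j t := by simp only at ht0; linarith
  rcases Set.mem_uIcc.1 ht with ⟨a, b⟩ | ⟨a, b⟩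
  · have a' := lt_of_le_of_ne a htx.symm
    have b' := lt_of_le_of_ne b htx'
    exact S.line_ne hij (by linarith) (by linarith) (by linarith) (by linarith) h0
  · have a' := lt_of_le_of_ne a htx'.symm
    have b' := lt_of_le_of_ne b htx
    exact S.line_ne hij (by linarith) (by linarith) (by linarith) (by linarith) h0

/-- The segment `j` passes above the segment `i`. -/
def Above (i j : I) : Prop :=
  ∃ x, ((S.l i).1 < x ∧ x < (S.r i).1) ∧ ((S.l j).1 < x ∧ x < (S.r j).1) ∧ S.line i x < S.line j x

lemma not_above_self (i : I) : ¬ S.Above i i := by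
  rintro ⟨x, -, -, h⟩
  exact lt_irrefl _ h

/-- Since the order of two segments never changes, `Above` may be tested at any common abscissa
where they differ, in particular at an end of one of them. -/
lemma above_iff {i j : I} (hij : i ≠ j) (hov : (S.l i).1 < (S.r j).1) (hov' : (S.l j).1 < (S.r i).1)
    {x : ℝ} (h1 : (S.l i).1 ≤ x) (h2 : x ≤ (S.r i).1) (h3 : (S.l j).1 ≤ x) (h4 : x ≤ (S.r j).1)
    (hne : S.line i x ≠ S.line j x) : S.Above i j ↔ S.line i x < S.line j x := by
  constructor
  · rintro ⟨t, ⟨a, b⟩, ⟨c, d⟩, h⟩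
    exact lt_of_le_of_ne (S.line_le hij a.le b.le c.le d.le h1 h2 h3 h4 h) hne
  · intro h
    have hlt : max (S.l i).1 (S.l j).1 < min (S.r i).1 (S.r j).1 :=
      max_lt (lt_min (S.lt i) hov) (lt_min hov' (S.lt j))
    obtain ⟨t, ht1, ht2⟩ := exists_between hlt
    obtain ⟨a, c⟩ := max_lt_iff.1 ht1
    obtain ⟨b, d⟩ := lt_min_iff.1 ht2
    exact ⟨t, ⟨a, b⟩, ⟨c, d⟩, lt_of_le_of_ne (S.line_le hij h1 h2 h3 h4 a.le b.le c.le d.le h)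
      (S.line_ne hij a b c.le d.le)⟩

/-- The point `p` lies strictly above the interior of the segment `i`. -/
def PointAbove (i : I) (p : ℝ × ℝ) : Prop :=
  (S.l i).1 < p.1 ∧ p.1 < (S.r i).1 ∧ S.line i p.1 < p.2

open Classical in
/-- The number modulo 2 of segments strictly above the segment `i` at its left end. -/
noncomputable def leftCount [Fintype I] (w : I → ZMod 2) (i : I) : ZMod 2 :=
  ∑ j, if (S.l j).1 ≤ (S.l i).1 ∧ (S.l i).1 < (S.r j).1 ∧ S.Above i j then w j else 0

open Classical in
/-- The number modulo 2 of segments strictly above the segment `i` at its right end. -/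
noncomputable def rightCount [Fintype I] (w : I → ZMod 2) (i : I) : ZMod 2 :=
  ∑ j, if (S.l j).1 < (S.r i).1 ∧ (S.r i).1 ≤ (S.r j).1 ∧ S.Above i j then w j else 0

open Classical in
/-- Every point is an end point of an even number of the segments counted by `w`. -/
def Even [Fintype I] (w : I → ZMod 2) : Prop :=
  ∀ p, (∑ j, if S.l j = p then w j else 0) + (∑ j, if S.r j = p then w j else 0) = 0

open Classical in
lemma sum_points_eq_zero [Fintype I] {w : I → ZMod 2} (hw : S.Even w) (P : ℝ × ℝ → Prop) :
    (∑ j, if P (S.l j) then w j else 0) + (∑ j, if P (S.r j) then w j else 0) = 0 := by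
  let T : Finset (ℝ × ℝ) := Finset.univ.image S.l ∪ Finset.univ.image S.r
  have key : ∀ f : I → ℝ × ℝ, (∀ j, f j ∈ T) →
      (∑ j, if P (f j) then w j else 0) =
        ∑ p ∈ T.filter P, ∑ j, if f j = p then w j else 0 := by
    intro f hf
    rw [Finset.sum_comm]
    refine Finset.sum_congr rfl fun j _ => ?_
    rw [Finset.sum_ite_eq]
    simp [hf j]
  rw [key S.l (fun j => by simp [T]), key S.r (fun j => by simp [T]), ← Finset.sum_add_distrib]
  exact Finset.sum_eq_zero fun p _ => hw p

lemma ne_of_mem_interior_left {i j : I} (hij : i ≠ j) (h1 : (S.l i).1 < (S.l j).1)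
    (h2 : (S.l j).1 < (S.r i).1) : S.line i (S.l j).1 ≠ S.line j (S.l j).1 :=
  S.line_ne hij h1 h2 le_rfl (S.lt j).le

lemma ne_of_mem_interior_right {i j : I} (hij : i ≠ j) (h1 : (S.l i).1 < (S.r j).1)
    (h2 : (S.r j).1 < (S.r i).1) : S.line i (S.r j).1 ≠ S.line j (S.r j).1 :=
  S.line_ne hij h1 h2 (S.lt j).le le_rfl

lemma pointAbove_left_iff {i j : I} (hij : i ≠ j) : S.PointAbove i (S.l j) ↔
    ((S.l i).1 < (S.l j).1 ∧ (S.l j).1 < (S.r i).1 ∧ S.Above i j) := by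
  unfold PointAbove
  refine and_congr_right fun h1 => and_congr_right fun h2 => ?_
  rw [S.above_iff hij (h1.trans (S.lt j)) h2 h1.le h2.le le_rfl (S.lt j).le
    (S.ne_of_mem_interior_left hij h1 h2), S.line_left j]

lemma pointAbove_right_iff {i j : I} (hij : i ≠ j) : S.PointAbove i (S.r j) ↔
    ((S.l i).1 < (S.r j).1 ∧ (S.r j).1 < (S.r i).1 ∧ S.Above i j) := by
  unfold PointAbove
  refine and_congr_right fun h1 => and_congr_right fun h2 => ?_
  rw [S.above_iff hij h1 ((S.lt j).trans h2) h1.le h2.le (S.lt j).le le_rfl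
    (S.ne_of_mem_interior_right hij h1 h2), S.line_right j]

lemma not_pointAbove_self_left (i : I) : ¬ S.PointAbove i (S.l i) := fun h => lt_irrefl _ h.1

lemma not_pointAbove_self_right (i : I) : ¬ S.PointAbove i (S.r i) := fun h => lt_irrefl _ h.2.1

/-- Along a segment the parity of the number of segments above it does not change. -/
lemma leftCount_eq_rightCount [Fintype I] {w : I → ZMod 2} (hw : S.Even w) (i : I) :
    S.leftCount w i = S.rightCount w i := by
  classical
  -- For a segment above `i`, each of its two ends either lies above the interior of `i`, or the
  -- segment is counted at the corresponding end of `i`. So its four possible contributions add up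
  -- to twice its weight, and the ends above the interior of `i` have even total.
  have h := S.sum_points_eq_zero hw (S.PointAbove i)
  have h2 : S.leftCount w i + S.rightCount w i = 0 := by
    rw [← h, leftCount, rightCount, ← Finset.sum_add_distrib, ← Finset.sum_add_distrib]
    refine Finset.sum_congr rfl fun j _ => ?_
    by_cases hij : i = j
    · subst hij
      simp [S.not_above_self, S.not_pointAbove_self_left, S.not_pointAbove_self_right]
    · rw [S.pointAbove_left_iff hij, S.pointAbove_right_iff hij]
      by_cases ha : S.Above i j
      · obtain ⟨x, ⟨a, b⟩, ⟨c, d⟩, -⟩ := id ha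
        have e1 := a.trans d
        have e2 := c.trans b
        have hz : w j + w j = 0 := CharTwo.add_self_eq_zero _
        simp only [ha, e1, e2, and_true, true_and]
        rcases le_or_gt (S.l j).1 (S.l i).1 with f1 | f1 <;>
          rcases le_or_gt (S.r i).1 (S.r j).1 with f2 | f2 <;>
          simp [f1, f2, not_lt.2, not_le.2, hz]
      · simp [ha]
  exact CharTwo.add_eq_zero.1 h2

end SegmentSystem

/-! ### Sides of directed segments and the cyclic order at a point -/

namespace SegmentSystem

variable {I : Type*} (S : SegmentSystem I)

/-- The starting point of a directed segment; `(i, true)` is directed to the right. -/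
def start (d : I × Bool) : ℝ × ℝ := if d.2 then S.l d.1 else S.r d.1

/-- The position of a directed segment in the counterclockwise order around its start. -/
noncomputable def key (d : I × Bool) : Bool ×ₗ ℝ := toLex (!d.2, S.slope d.1)

/-- The parity of the number of segments above a point to the left of a directed segment. -/
noncomputable def side [Fintype I] (w : I → ZMod 2) (d : I × Bool) : ZMod 2 :=
  S.leftCount w d.1 + if d.2 then 0 else w d.1

lemma slope_ne_of_left_eq {i j : I} (hij : i ≠ j) (h : S.l i = S.l j) : S.slope i ≠ S.slope j := by
  intro hs
  obtain ⟨x, h1, h2⟩ := exists_between (lt_min (S.lt i) (h ▸ S.lt j : (S.l i).1 < (S.r j).1))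
  obtain ⟨h2, h3⟩ := lt_min_iff.1 h2
  exact S.line_ne hij h1 h2 (h ▸ h1.le) h3.le (by simp [line, h, hs])

lemma slope_ne_of_right_eq {i j : I} (hij : i ≠ j) (h : S.r i = S.r j) :
    S.slope i ≠ S.slope j := by
  intro hs
  obtain ⟨x, h1, h2⟩ := exists_between (max_lt (S.lt i) (h ▸ S.lt j : (S.l j).1 < (S.r i).1))
  obtain ⟨h1, h3⟩ := max_lt_iff.1 h1
  refine S.line_ne hij h1 h2 h3.le (h ▸ h2.le) ?_
  have e1 := S.line_sub i x (S.r i).1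
  have e2 := S.line_sub j x (S.r j).1
  rw [S.line_right] at e1 e2
  rw [← h, ← hs] at e2
  linarith

lemma key_injective {d d' : I × Bool} (h : S.start d = S.start d') (hk : S.key d = S.key d') :
    d = d' := by
  obtain ⟨i, b⟩ := d
  obtain ⟨j, c⟩ := d'
  simp only [key, EmbeddingLike.apply_eq_iff_eq, Prod.mk.injEq, Bool.not_inj_iff] at hk
  obtain ⟨rfl, hs⟩ := hk
  by_contra hne
  have hij : i ≠ j := fun e => hne (by rw [e])
  cases b
  · exact S.slope_ne_of_right_eq hij (by simpa [start] using h) hs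
  · exact S.slope_ne_of_left_eq hij (by simpa [start] using h) hs

open Classical in
/-- The parity of the number of segments that pass strictly above a point. -/
noncomputable def pointCount [Fintype I] (w : I → ZMod 2) (p : ℝ × ℝ) : ZMod 2 :=
  ∑ j, if (S.l j).1 < p.1 ∧ p.1 < (S.r j).1 ∧ p.2 < S.line j p.1 then w j else 0

open Classical in
/-- The parity of the number of segments with a given left end. -/
noncomputable def rightDegree [Fintype I] (w : I → ZMod 2) (p : ℝ × ℝ) : ZMod 2 :=
  ∑ j, if S.l j = p then w j else 0

/-- A segment above `i` at its left end either passes strictly over that point or starts there with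
larger slope. This splits `leftCount` into a part that depends on the point only and a part read off
from the cyclic order. -/
lemma left_le_and_lt_and_above_iff (i j : I) :
    ((S.l j).1 ≤ (S.l i).1 ∧ (S.l i).1 < (S.r j).1 ∧ S.Above i j) ↔
      ((S.l j).1 < (S.l i).1 ∧ (S.l i).1 < (S.r j).1 ∧ (S.l i).2 < S.line j (S.l i).1) ∨
        (S.l j = S.l i ∧ S.slope i < S.slope j) := by
  by_cases hij : i = j
  · subst hij; simp [S.not_above_self]
  have hne := fun h h' => (S.ne_of_mem_interior_left (Ne.symm hij) h h').symm
  constructor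
  · rintro ⟨h1, h2, h3⟩
    rcases h1.lt_or_eq with h1 | h1
    · refine Or.inl ⟨h1, h2, ?_⟩
      rwa [S.above_iff hij h2 (h1.trans (S.lt i)) le_rfl (S.lt i).le h1.le h2.le (hne h1 h2),
        S.line_left] at h3
    · have e := S.left_left _ _ h1
      refine Or.inr ⟨e, ?_⟩
      obtain ⟨x, ⟨a, b⟩, -, h⟩ := h3
      simp only [line, e] at h
      by_contra! hh
      nlinarith
  · rintro (⟨h1, h2, h3⟩ | ⟨h1, h2⟩)
    · refine ⟨h1.le, h2, ?_⟩
      rwa [S.above_iff hij h2 (h1.trans (S.lt i)) le_rfl (S.lt i).le h1.le h2.le (hne h1 h2),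
        S.line_left]
    · refine ⟨h1 ▸ le_rfl, h1 ▸ S.lt j, ?_⟩
      obtain ⟨x, h3, h4⟩ := exists_between
        (lt_min (S.lt i) (h1 ▸ S.lt j : (S.l i).1 < (S.r j).1))
      obtain ⟨h4, h5⟩ := lt_min_iff.1 h4
      refine ⟨x, ⟨h3, h4⟩, ⟨h1 ▸ h3, h5⟩, ?_⟩
      simp only [line, h1]
      nlinarith

lemma right_lt_and_le_and_above_iff (i j : I) :
    ((S.l j).1 < (S.r i).1 ∧ (S.r i).1 ≤ (S.r j).1 ∧ S.Above i j) ↔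
      ((S.l j).1 < (S.r i).1 ∧ (S.r i).1 < (S.r j).1 ∧ (S.r i).2 < S.line j (S.r i).1) ∨
        (S.r j = S.r i ∧ S.slope j < S.slope i) := by
  by_cases hij : i = j
  · subst hij; simp [S.not_above_self]
  have hne := fun h h' => (S.ne_of_mem_interior_right (Ne.symm hij) h h').symm
  have hline : ∀ {x}, S.r j = S.r i →
      S.line i x - S.line j x = (S.slope i - S.slope j) * (x - (S.r i).1) := by
    intro x h
    have e1 := S.line_sub i x (S.r i).1
    have e2 := S.line_sub j x (S.r j).1
    rw [S.line_right] at e1 e2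
    rw [h] at e2
    linarith
  constructor
  · rintro ⟨h1, h2, h3⟩
    rcases h2.lt_or_eq with h2 | h2
    · refine Or.inl ⟨h1, h2, ?_⟩
      rwa [S.above_iff hij ((S.lt i).trans h2) h1 (S.lt i).le le_rfl h1.le h2.le (hne h1 h2),
        S.line_right] at h3
    · have e := S.right_right _ _ h2.symm
      refine Or.inr ⟨e, ?_⟩
      obtain ⟨x, ⟨a, b⟩, -, h⟩ := h3
      have := hline (x := x) e
      by_contra! hh
      nlinarith
  · rintro (⟨h1, h2, h3⟩ | ⟨h1, h2⟩)
    · refine ⟨h1, h2.le, ?_⟩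
      rwa [S.above_iff hij ((S.lt i).trans h2) h1 (S.lt i).le le_rfl h1.le h2.le (hne h1 h2),
        S.line_right]
    · refine ⟨h1 ▸ S.lt j, h1 ▸ le_rfl, ?_⟩
      obtain ⟨x, h3, h4⟩ := exists_between
        (max_lt (S.lt i) (h1 ▸ S.lt j : (S.l j).1 < (S.r i).1))
      obtain ⟨h3, h5⟩ := max_lt_iff.1 h3
      refine ⟨x, ⟨h3, h4⟩, ⟨h5, h1 ▸ h4⟩, ?_⟩
      have := hline (x := x) h1
      nlinarith

open Classical in
lemma leftCount_eq [Fintype I] (w : I → ZMod 2) (i : I) :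
    S.leftCount w i = S.pointCount w (S.l i) +
      ∑ j, if S.l j = S.l i ∧ S.slope i < S.slope j then w j else 0 := by
  rw [leftCount, pointCount, ← Finset.sum_add_distrib]
  refine Finset.sum_congr rfl fun j _ => ?_
  simp only [S.left_le_and_lt_and_above_iff]
  by_cases h : S.l j = S.l i <;> simp [h]

open Classical in
lemma rightCount_eq [Fintype I] (w : I → ZMod 2) (i : I) :
    S.rightCount w i = S.pointCount w (S.r i) +
      ∑ j, if S.r j = S.r i ∧ S.slope j < S.slope i then w j else 0 := by
  rw [rightCount, pointCount, ← Finset.sum_add_distrib]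
  refine Finset.sum_congr rfl fun j _ => ?_
  simp only [S.right_lt_and_le_and_above_iff]
  by_cases h : S.r j = S.r i <;> simp [h]

open Classical in
/-- Around a point the parity to the left of a directed segment changes with each segment that is
passed. -/
lemma side_eq [Fintype I] {w : I → ZMod 2} (hw : S.Even w) (d : I × Bool) :
    S.side w d = S.pointCount w (S.start d) + S.rightDegree w (S.start d) +
      ∑ d', if S.start d' = S.start d ∧ S.key d' ≤ S.key d then w d'.1 else 0 := by
  obtain ⟨i, b⟩ := d
  rw [Fintype.sum_prod_type]
  cases b
  · have h : ∀ j, (∑ b, if S.start (j, b) = S.start (i, false) ∧ S.key (j, b) ≤ S.key (i, false)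
        then w j else 0) = (if S.l j = S.r i then w j else 0) +
          ((if S.r j = S.r i ∧ S.slope j < S.slope i then w j else 0) +
            if i = j then w j else 0) := by
      intro j
      simp only [Fintype.sum_bool, start, key, Prod.Lex.toLex_le_toLex]
      by_cases hij : i = j
      · simp [hij]
      · by_cases hr : S.r j = S.r i
        · have := S.slope_ne_of_right_eq (Ne.symm hij) hr
          simp [hr, hij, le_iff_lt_or_eq, this]
        · simp [hr, hij]
    simp only [h, Finset.sum_add_distrib, Finset.sum_ite_eq, Finset.mem_univ, if_true]
    -- A segment directed to the left starts at its right end, so the count is moved there; this is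
    -- where evenness enters. All rightward segments at that point precede it in the order, and they
    -- cancel `rightDegree`.
    simp only [side, S.leftCount_eq_rightCount hw, S.rightCount_eq, start, rightDegree]
    have := CharTwo.add_self_eq_zero (∑ j, if S.l j = S.r i then w j else 0)
    simp
    linear_combination -this
  · have h : ∀ j, (∑ b, if S.start (j, b) = S.start (i, true) ∧ S.key (j, b) ≤ S.key (i, true)
        then w j else 0) = if S.l j = S.l i ∧ S.slope j ≤ S.slope i then w j else 0 := by
      intro j
      simp [start, key, Prod.Lex.toLex_le_toLex]
    rw [Finset.sum_congr rfl fun j _ => h j]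
    simp only [side, S.leftCount_eq, start, rightDegree, if_true, add_zero]
    rw [add_assoc, ← Finset.sum_add_distrib]
    congr 1
    refine Finset.sum_congr rfl fun j _ => ?_
    have hz : w j + w j = 0 := CharTwo.add_self_eq_zero _
    by_cases hl : S.l j = S.l i
    · rcases le_or_gt (S.slope j) (S.slope i) with h | h <;> simp [hl, h, not_lt.2, not_le.2, hz]
    · simp [hl]

end SegmentSystem

/-! ### Cyclic successors in finite linear orders and in fibres -/

lemma Equiv.Perm.SameCycle.map_semiconj {A B : Type*} [Finite A] {f : Equiv.Perm A}
    {g : Equiv.Perm B} {h : A → B} (hh : ∀ a, h (f a) = g (h a)) {a a' : A}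
    (hf : f.SameCycle a a') : g.SameCycle (h a) (h a') := by
  obtain ⟨k, rfl⟩ := hf.exists_nat_pow_eq
  refine ⟨k, ?_⟩
  have := (Function.Semiconj.iterate_right (f := h) (ga := f) (gb := g) hh k) a
  simpa [Equiv.Perm.iterate_eq_pow] using this.symm

open Classical in
-- Partial sums of `w` grow by one term at each successor. The rule also holds when wrapping from
-- the last element to the first, because the total weight vanishes.
lemma exists_cyclic_succ_fin (n : ℕ) : ∃ rot : Equiv.Perm (Fin n), (∀ d d', rot.SameCycle d d') ∧
    ∀ w : Fin n → ZMod 2, ∑ d, w d = 0 → ∀ d,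
      (∑ d', if d' ≤ rot d then w d' else 0) = (∑ d', if d' ≤ d then w d' else 0) + w (rot d) := by
  refine ⟨finRotate n, ?_, ?_⟩
  · intro d d'
    rcases lt_or_ge n 2 with h | h
    · have : Subsingleton (Fin n) := Fin.subsingleton_iff_le_one.2 (by omega)
      rw [Subsingleton.elim d d']
    · have h1 := support_finRotate_of_le h
      have hs : ∀ x, finRotate n x ≠ x := fun x => by
        rw [← Equiv.Perm.mem_support, h1]; exact Finset.mem_univ _
      exact (isCycle_finRotate_of_le h).sameCycle (hs d) (hs d')
  · intro w hw d
    obtain _ | n := n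
    · exact d.elim0
    rw [finRotate_apply]
    rcases eq_or_ne d (Fin.last n) with rfl | hd
    · have h1 : ∀ d' : Fin (n + 1), d' ≤ 0 ↔ d' = 0 := fun d' => Fin.le_zero_iff
      simp [h1, Fin.le_last, hw]
    · have hlt : d.val < n := Fin.val_lt_last hd
      have hv : (d + 1).val = d.val + 1 := Fin.val_add_one_of_lt (Fin.lt_last_iff_ne_last.2 hd)
      have : w (d + 1) = ∑ d', if d' = d + 1 then w d' else 0 := by simp
      rw [this, ← Finset.sum_add_distrib]
      refine Finset.sum_congr rfl fun x _ => ?_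
      have h1 : x ≤ d + 1 ↔ x.val ≤ d.val + 1 := by rw [Fin.le_def, hv]
      have h2 : x = d + 1 ↔ x.val = d.val + 1 := by rw [Fin.ext_iff, hv]
      simp only [h1, h2, Fin.le_def]
      rcases lt_trichotomy x.val (d.val + 1) with h | h | h
      · simp [h.le, h.ne, Nat.le_of_lt_succ h]
      · simp [h]
      · simp [h.ne', not_le.2 h, not_le.2 (Nat.lt_of_succ_lt h)]

open Classical in
lemma exists_cyclic_succ_of_linearOrder (F : Type*) [Fintype F] [LinearOrder F] :
    ∃ rot : Equiv.Perm F, (∀ d d', rot.SameCycle d d') ∧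
    ∀ w : F → ZMod 2, ∑ d, w d = 0 → ∀ d,
      (∑ d', if d' ≤ rot d then w d' else 0) = (∑ d', if d' ≤ d then w d' else 0) + w (rot d) := by
  obtain ⟨rot, h1, h2⟩ := exists_cyclic_succ_fin (Fintype.card F)
  let e : Fin (Fintype.card F) ≃o F := Fintype.orderIsoFinOfCardEq F rfl
  refine ⟨(e.symm.toEquiv.trans rot).trans e.toEquiv, fun d d' => ?_, fun w hw d => ?_⟩
  · have := (h1 (e.symm d) (e.symm d')).map_semiconj (h := e)
      (g := (e.symm.toEquiv.trans rot).trans e.toEquiv) (by simp)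
    simpa using this
  · have h := h2 (fun i => w (e i)) (by rw [← hw]; exact Fintype.sum_equiv e.toEquiv _ _ (by simp))
      (e.symm d)
    rw [← Fintype.sum_equiv e.toEquiv (fun i => if i ≤ rot (e.symm d) then w (e i) else 0) _
        (fun i => by simp),
      ← Fintype.sum_equiv e.toEquiv (fun i => if i ≤ e.symm d then w (e i) else 0) _
        (fun i => by simp [← e.le_symm_apply])]
    simpa using h

open Classical in
/-- The cyclic successor in each fibre of a map, with respect to a linear order of the fibre. -/
theorem exists_cyclic_succ {D V K : Type*} [Fintype D] [LinearOrder K] (π : D → V) (key : D → K)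
    (hinj : ∀ d d', π d = π d' → key d = key d' → d = d') :
    ∃ rot : Equiv.Perm D, (∀ d, π (rot d) = π d) ∧ (∀ d d', π d = π d' → rot.SameCycle d d') ∧
    ∀ w : D → ZMod 2, (∀ v, (∑ d, if π d = v then w d else 0) = 0) → ∀ d,
      (∑ d', if π d' = π d ∧ key d' ≤ key (rot d) then w d' else 0) =
        (∑ d', if π d' = π d ∧ key d' ≤ key d then w d' else 0) + w (rot d) := by
  let F : V → Type _ := fun v => {d // π d = v}
  let ord : ∀ v, LinearOrder (F v) := fun v =>
    LinearOrder.lift' (fun d : F v => key d.1)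
      (fun d d' h => Subtype.ext (hinj _ _ (d.2.trans d'.2.symm) h))
  have hF : ∀ v, ∃ rot : Equiv.Perm (F v), (∀ d d', rot.SameCycle d d') ∧
    ∀ w : F v → ZMod 2, ∑ d, w d = 0 → ∀ d,
      (∑ d' : F v, if key d'.1 ≤ key (rot d).1 then w d' else 0) =
        (∑ d' : F v, if key d'.1 ≤ key d.1 then w d' else 0) + w (rot d) := fun v =>
    exists_cyclic_succ_of_linearOrder (F v)
  choose rot h1 h2 using hF
  have hsum : ∀ (v : V) (P : D → Prop) [DecidablePred P] (w : D → ZMod 2),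
      (∑ d, if π d = v ∧ P d then w d else 0) = ∑ d : F v, if P d.1 then w d.1 else 0 := by
    intro v P _ w
    simp only [ite_and]
    rw [← Finset.sum_filter, ← Finset.sum_subtype_eq_sum_filter]
    simp [F]
  let R : Equiv.Perm D := ((Equiv.sigmaFiberEquiv π).symm.trans (Equiv.sigmaCongrRight rot)).trans
    (Equiv.sigmaFiberEquiv π)
  have hR : ∀ v (d : F v), R d.1 = (rot v d).1 := by
    rintro _ ⟨d, rfl⟩
    rfl
  refine ⟨R, fun d => (rot _ ⟨d, rfl⟩).2, fun d d' h => ?_, fun w hw d => ?_⟩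
  · exact (h1 (π d) ⟨d, rfl⟩ ⟨d', h.symm⟩).map_semiconj (h := Subtype.val)
      (fun x => (hR _ x).symm)
  · have hz : ∑ x : F (π d), w x.1 = 0 := by
      rw [← hw (π d)]
      simpa using (hsum (π d) (fun _ => True) w).symm
    have := h2 (π d) (fun x => w x.1) hz ⟨d, rfl⟩
    rw [hR _ ⟨d, rfl⟩, hsum (π d) (fun d' => key d' ≤ key ((rot (π d)) ⟨d, rfl⟩).1) w,
      hsum (π d) (fun d' => key d' ≤ key d) w]
    exact this

/-! ### Polyline drawings in general position -/

/-- A drawing of a graph by polygonal lines, given by their corners, such that distinct corners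
have distinct first coordinates. -/
structure PolylineDrawing {V : Type*} (G : SimpleGraph V) where
  pos : V → ℝ × ℝ
  dart : G.edgeSet → G.Dart
  n : G.edgeSet → ℕ
  x : G.edgeSet → ℕ → ℝ × ℝ
  pos_injective : Function.Injective pos
  dart_edge : ∀ e, (dart e).edge = e
  n_pos : ∀ e, 0 < n e
  x_zero : ∀ e, x e 0 = pos (dart e).fst
  x_n : ∀ e, x e (n e) = pos (dart e).snd
  x_ne : ∀ e i, i < n e → x e i ≠ x e (i + 1)
  cross : ∀ e i e' i', i < n e → i' < n e' → (e = e' → i ≠ i') →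
    ∀ z ∈ segment ℝ (x e i) (x e (i + 1)), z ∈ segment ℝ (x e' i') (x e' (i' + 1)) →
      z = x e i ∨ z = x e (i + 1)
  eq_zero_or_eq_n : ∀ e i v, i ≤ n e → x e i = pos v → i = 0 ∨ i = n e
  bend : ∀ e i e' i', i ≤ n e → i' ≤ n e' → 0 < i → i < n e → x e i = x e' i' → e = e' ∧ i = i'
  generic : ∀ e i e' i', i ≤ n e → i' ≤ n e' → (x e i).1 = (x e' i').1 → x e i = x e' i'

/-- Two points of different height become vertically aligned for just one value of `c`, so only
finitely many values are bad. -/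
lemma exists_shear {s : Set (ℝ × ℝ)} (hs : s.Finite) :
    ∃ c : ℝ, ∀ p ∈ s, ∀ q ∈ s, p.1 + c * p.2 = q.1 + c * q.2 → p = q := by
  have hfin : ((fun pq : (ℝ × ℝ) × (ℝ × ℝ) => (pq.1.1 - pq.2.1) / (pq.2.2 - pq.1.2)) ''
      (s ×ˢ s)).Finite := (hs.prod hs).image _
  obtain ⟨c, hc⟩ := hfin.infinite_compl.nonempty
  refine ⟨c, fun p hp q hq h => ?_⟩
  by_cases h2 : p.2 = q.2
  · ext
    · rw [h2] at h; linarith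
    · exact h2
  · exfalso
    refine hc ⟨(p, q), ⟨hp, hq⟩, ?_⟩
    have : q.2 - p.2 ≠ 0 := fun h' => h2 (by linarith)
    simp only
    field_simp
    linarith

/-- The linear map `(a, b) ↦ (a + c * b, b)`. -/
def shear (c : ℝ) : ℝ × ℝ →ₗ[ℝ] ℝ × ℝ :=
  (LinearMap.fst ℝ ℝ ℝ + c • LinearMap.snd ℝ ℝ ℝ).prod (LinearMap.snd ℝ ℝ ℝ)

lemma shear_apply (c : ℝ) (p : ℝ × ℝ) : shear c p = (p.1 + c * p.2, p.2) := rfl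

lemma shear_injective (c : ℝ) : Function.Injective (shear c) := by
  intro p q h
  simp only [shear_apply, Prod.mk.injEq] at h
  ext
  · have := h.1; rw [h.2] at this; linarith
  · exact h.2

lemma shear_mem_segment {c : ℝ} {p q z : ℝ × ℝ} (h : z ∈ segment ℝ (shear c p) (shear c q)) :
    ∃ y ∈ segment ℝ p q, shear c y = z := by
  rw [← LinearMap.coe_toAffineMap, ← image_segment] at h
  exact h

section Polyline

variable {n : ℕ} {x : ℕ → ℝ × ℝ}

lemma polyline_index_of_mem (hne : ∀ i < n, x i ≠ x (i + 1))
    (hcross : ∀ i j, i < j → j < n → ∀ z ∈ segment ℝ (x i) (x (i + 1)),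
      z ∈ segment ℝ (x j) (x (j + 1)) → j = i + 1 ∧ z = x j)
    {i j : ℕ} (hi : i < n) (hj : j ≤ n) (h : x j ∈ segment ℝ (x i) (x (i + 1))) :
    j = i ∨ j = i + 1 := by
  rcases hj.lt_or_eq with hj | rfl
  · rcases lt_trichotomy i j with hij | rfl | hij
    · exact Or.inr (hcross i j hij hj _ h (left_mem_segment ..)).1
    · exact Or.inl rfl
    · obtain ⟨rfl, h2⟩ := hcross j i hij hi _ (left_mem_segment ..) h
      exact absurd h2 (hne j hj)
  · obtain ⟨m, rfl⟩ : ∃ m, j = m + 1 := ⟨j - 1, by omega⟩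
    rcases (Nat.lt_succ_iff.1 hi).lt_or_eq with him | rfl
    · exact absurd (hcross i m him (by omega) _ h (right_mem_segment ..)).2.symm (hne m (by omega))
    · exact Or.inr rfl

lemma polyline_injective (hne : ∀ i < n, x i ≠ x (i + 1))
    (hcross : ∀ i j, i < j → j < n → ∀ z ∈ segment ℝ (x i) (x (i + 1)),
      z ∈ segment ℝ (x j) (x (j + 1)) → j = i + 1 ∧ z = x j)
    {i j : ℕ} (hi : i ≤ n) (hj : j ≤ n) (h : x i = x j) : i = j := by
  wlog hlt : i < j generalizing i j
  · rcases lt_trichotomy i j with h' | h' | h'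
    · exact absurd h' hlt
    · exact h'
    · exact (this hj hi h.symm h').symm
  rcases polyline_index_of_mem hne hcross (hlt.trans_le hj) hj (h ▸ left_mem_segment ..) with h' | rfl
  · exact h'.symm
  · exact absurd h (hne i (by omega))

end Polyline

/-- A shear is linear and injective, so it preserves segments and their incidences; a generic one
makes the first coordinates of distinct corners distinct. -/
theorem IsPlanar.exists_polylineDrawing {V : Type*} [Finite V] {G : SimpleGraph V}
    (hG : IsPlanar G) : Nonempty (PolylineDrawing G) := by
  obtain ⟨D⟩ := hG
  have hex : ∀ e : G.edgeSet, ∃ (d : G.Dart) (n : ℕ) (x : ℕ → ℝ × ℝ), d.edge = e ∧ 1 ≤ n ∧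
      x 0 = D.pos d.fst ∧ x n = D.pos d.snd ∧ (∀ i < n, x i ≠ x (i + 1)) ∧
      (∀ i j, i < j → j < n → ∀ z ∈ segment ℝ (x i) (x (i + 1)),
        z ∈ segment ℝ (x j) (x (j + 1)) → j = i + 1 ∧ z = x j) ∧
      D.arc e = ⋃ i ∈ Set.Iio n, segment ℝ (x i) (x (i + 1)) := by
    rintro ⟨e, he⟩
    induction e with
    | h u v =>
      obtain ⟨n, x, h⟩ := D.isPolygonalArc_arc u v he
      exact ⟨⟨(u, v), he⟩, n, x, rfl, h⟩
  choose d n x hd hn h0 h1 hne hcr harc using hex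
  have hmem : ∀ e i, i < n e → ∀ z ∈ segment ℝ (x e i) (x e (i + 1)), z ∈ D.arc e := by
    intro e i hi z hz
    rw [harc]
    exact Set.mem_biUnion (Set.mem_Iio.2 hi) hz
  have hmem' : ∀ e i, i ≤ n e → x e i ∈ D.arc e := by
    intro e i hi
    rcases hi.lt_or_eq with hi | rfl
    · exact hmem e i hi _ (left_mem_segment ..)
    · refine hmem e (n e - 1) (by have := hn e; omega) _ ?_
      have := hn e
      rw [Nat.sub_add_cancel this]
      exact right_mem_segment ..
  have hend : ∀ (e : G.edgeSet) w, w ∈ e.1 → D.pos w = x e 0 ∨ D.pos w = x e (n e) := by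
    intro e w hw
    rw [← hd e, SimpleGraph.Dart.edge, Sym2.mem_iff] at hw
    rw [h0, h1]
    rcases hw with rfl | rfl
    · exact Or.inl rfl
    · exact Or.inr rfl
  have hvert : ∀ e i v, i ≤ n e → x e i = D.pos v → i = 0 ∨ i = n e := by
    intro e i v hi h
    rcases hend e v (D.mem_of_pos_mem_arc e e.2 v (h ▸ hmem' e i hi)) with h' | h'
    · exact Or.inl (polyline_injective (hne e) (hcr e) hi (Nat.zero_le _) (h.trans h'))
    · exact Or.inr (polyline_injective (hne e) (hcr e) hi le_rfl (h.trans h'))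
  have hfin : (⋃ e : G.edgeSet, (x e) '' Set.Iic (n e)).Finite :=
    Set.finite_iUnion fun e => (Set.finite_Iic _).image _
  obtain ⟨c, hc⟩ := exists_shear hfin
  have hpt : ∀ e i, i ≤ n e → x e i ∈ ⋃ e : G.edgeSet, (x e) '' Set.Iic (n e) :=
    fun e i hi => Set.mem_iUnion.2 ⟨e, i, hi, rfl⟩
  refine ⟨{ pos := fun v => shear c (D.pos v), dart := d, n := n, x := fun e i => shear c (x e i)
            pos_injective := (shear_injective c).comp D.pos_injective
            dart_edge := hd, n_pos := hn, x_zero := fun e => by rw [h0]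
            x_n := fun e => by rw [h1]
            x_ne := fun e i hi h => hne e i hi (shear_injective c h)
            cross := ?_, eq_zero_or_eq_n := fun e i v hi h => hvert e i v hi (shear_injective c h)
            bend := ?_
            generic := fun e i e' i' hi hi' h => by
              rw [hc _ (hpt e i hi) _ (hpt e' i' hi') h] }⟩
  · intro e i e' i' hi hi' hdiff z hz hz'
    obtain ⟨y, hy, rfl⟩ := shear_mem_segment hz
    obtain ⟨y', hy', hyy⟩ := shear_mem_segment hz'
    obtain rfl := shear_injective c hyy
    suffices y' = x e i ∨ y' = x e (i + 1) by
      rcases this with h | h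
      · exact Or.inl (by rw [h])
      · exact Or.inr (by rw [h])
    by_cases hee : e = e'
    · subst hee
      rcases lt_or_gt_of_ne (hdiff rfl) with h | h
      · obtain ⟨rfl, h2⟩ := hcr e i i' h hi' _ hy hy'
        exact Or.inr h2
      · exact Or.inl (hcr e i' i h hi _ hy' hy).2
    · obtain ⟨w, hw, -, rfl⟩ := D.arc_inter_arc e e.2 e' e'.2 (fun h => hee (Subtype.ext h)) _
        (hmem e i hi _ hy) (hmem e' i' hi' _ hy')
      obtain ⟨j, hj, hjw⟩ : ∃ j ≤ n e, D.pos w = x e j := by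
        rcases hend e w hw with h | h
        · exact ⟨0, Nat.zero_le _, h⟩
        · exact ⟨_, le_rfl, h⟩
      rw [hjw] at hy ⊢
      rcases polyline_index_of_mem (hne e) (hcr e) hi hj hy with rfl | rfl
      · exact Or.inl rfl
      · exact Or.inr rfl
  · intro e i e' i' hi hi' hi0 hin h
    have h := shear_injective c h
    have hee : e = e' := by
      by_contra hee
      obtain ⟨w, -, -, hw⟩ := D.arc_inter_arc e e.2 e' e'.2 (fun h => hee (Subtype.ext h)) _
        (hmem' e i hi) (h ▸ hmem' e' i' hi')
      have := hvert e i w hi hw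
      omega
    subst hee
    exact ⟨rfl, polyline_injective (hne e) (hcr e) hi hi' h⟩

/-! ### Edges of a drawing as chains of directed segments -/

namespace PolylineDrawing

variable {V : Type*} {G : SimpleGraph V} (D : PolylineDrawing G)

/-- The index type of the straight segments of a drawing. -/
abbrev Index : Type _ := Σ e : G.edgeSet, Fin (D.n e)

/-- The starting point of a segment along its edge. -/
def src (i : D.Index) : ℝ × ℝ := D.x i.1 i.2

/-- The final point of a segment along its edge. -/
def tgt (i : D.Index) : ℝ × ℝ := D.x i.1 (i.2 + 1)

open Classical in
/-- Whether a segment is traversed from left to right along its edge. -/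
noncomputable def toRight (i : D.Index) : Bool := decide ((D.src i).1 < (D.tgt i).1)

lemma generic_of_mem {p q : ℝ × ℝ} (hp : ∃ e i, i ≤ D.n e ∧ D.x e i = p)
    (hq : ∃ e i, i ≤ D.n e ∧ D.x e i = q) (h : p.1 = q.1) : p = q := by
  obtain ⟨e, i, hi, rfl⟩ := hp
  obtain ⟨e', i', hi', rfl⟩ := hq
  exact D.generic e i e' i' hi hi' h

lemma src_mem (i : D.Index) : ∃ e k, k ≤ D.n e ∧ D.x e k = D.src i :=
  ⟨i.1, i.2, i.2.2.le, rfl⟩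

lemma tgt_mem (i : D.Index) : ∃ e k, k ≤ D.n e ∧ D.x e k = D.tgt i :=
  ⟨i.1, i.2 + 1, i.2.2, rfl⟩

lemma src_ne_tgt (i : D.Index) : (D.src i).1 ≠ (D.tgt i).1 := fun h =>
  D.x_ne i.1 i.2 i.2.2 (D.generic_of_mem (D.src_mem i) (D.tgt_mem i) h)

/-- The left end of a segment. -/
noncomputable def leftEnd (i : D.Index) : ℝ × ℝ := if D.toRight i then D.src i else D.tgt i

/-- The right end of a segment. -/
noncomputable def rightEnd (i : D.Index) : ℝ × ℝ := if D.toRight i then D.tgt i else D.src i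

lemma leftEnd_mem (i : D.Index) : ∃ e k, k ≤ D.n e ∧ D.x e k = D.leftEnd i := by
  unfold leftEnd; split_ifs; exacts [D.src_mem i, D.tgt_mem i]

lemma rightEnd_mem (i : D.Index) : ∃ e k, k ≤ D.n e ∧ D.x e k = D.rightEnd i := by
  unfold rightEnd; split_ifs; exacts [D.tgt_mem i, D.src_mem i]

lemma segment_leftEnd_rightEnd (i : D.Index) :
    segment ℝ (D.leftEnd i) (D.rightEnd i) = segment ℝ (D.src i) (D.tgt i) := by
  unfold leftEnd rightEnd; split_ifs; exacts [rfl, segment_symm ..]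

/-- The straight segments of a drawing. -/
noncomputable def segments : SegmentSystem D.Index where
  l := D.leftEnd
  r := D.rightEnd
  lt i := by
    unfold leftEnd rightEnd toRight
    have := D.src_ne_tgt i
    by_cases h : (D.src i).1 < (D.tgt i).1
    · simp [h]
    · simpa [h] using lt_of_le_of_ne (not_lt.1 h) this.symm
  left_left i j := D.generic_of_mem (D.leftEnd_mem i) (D.leftEnd_mem j)
  left_right i j := D.generic_of_mem (D.leftEnd_mem i) (D.rightEnd_mem j)
  right_right i j := D.generic_of_mem (D.rightEnd_mem i) (D.rightEnd_mem j)
  cross i j hij z hz hz' := by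
    rw [segment_leftEnd_rightEnd] at hz hz'
    have := D.cross i.1 i.2 j.1 j.2 i.2.2 j.2.2 (fun h h' => hij (by
      obtain ⟨e, k⟩ := i
      obtain ⟨e', k'⟩ := j
      obtain rfl : e = e' := h
      exact congrArg _ (Fin.ext h'))) z hz hz'
    unfold leftEnd rightEnd
    split_ifs
    exacts [this, this.symm]

/-- A segment directed along its edge. -/
noncomputable def fwd (i : D.Index) : D.Index × Bool := (i, D.toRight i)

/-- A segment directed against its edge. -/
noncomputable def bwd (i : D.Index) : D.Index × Bool := (i, !D.toRight i)

lemma start_fwd (i : D.Index) : D.segments.start (D.fwd i) = D.src i := by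
  unfold SegmentSystem.start segments leftEnd rightEnd fwd
  simp only
  split_ifs <;> rfl

lemma start_bwd (i : D.Index) : D.segments.start (D.bwd i) = D.tgt i := by
  unfold SegmentSystem.start segments leftEnd rightEnd bwd
  cases h : D.toRight i <;> simp [h]

lemma eq_fwd_or_eq_bwd (d : D.Index × Bool) : d = D.fwd d.1 ∨ d = D.bwd d.1 := by
  obtain ⟨i, b⟩ := d
  unfold fwd bwd
  cases h : D.toRight i <;> cases b <;> simp

lemma fwd_ne_bwd (i : D.Index) : D.fwd i ≠ D.bwd i := by
  unfold fwd bwd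
  simp

/-- The first segment of an edge. -/
def firstIndex (e : G.edgeSet) : D.Index := ⟨e, ⟨0, D.n_pos e⟩⟩

/-- The last segment of an edge. -/
def lastIndex (e : G.edgeSet) : D.Index := ⟨e, ⟨D.n e - 1, Nat.sub_lt (D.n_pos e) one_pos⟩⟩

/-- The dart of an oriented edge. -/
def toDart (a : G.edgeSet × Bool) : G.Dart := if a.2 then D.dart a.1 else (D.dart a.1).symm

/-- The initial directed segment of an oriented edge. -/
noncomputable def first (a : G.edgeSet × Bool) : D.Index × Bool :=
  if a.2 then D.fwd (D.firstIndex a.1) else D.bwd (D.lastIndex a.1)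

lemma start_first (a : G.edgeSet × Bool) :
    D.segments.start (D.first a) = D.pos (D.toDart a).fst := by
  obtain ⟨e, b⟩ := a
  cases b
  · have := D.n_pos e
    have h : D.x e (D.n e - 1 + 1) = D.pos (D.dart e).snd := by
      rw [Nat.sub_add_cancel this, D.x_n]
    simpa only [first, toDart, start_bwd, tgt, lastIndex, Bool.false_eq_true, if_false]
  · simp [first, toDart, start_fwd, src, firstIndex, D.x_zero]

lemma first_fst_fst (a : G.edgeSet × Bool) : (D.first a).1.1 = a.1 := by
  obtain ⟨e, b⟩ := a
  cases b <;> rfl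

lemma first_injective : Function.Injective D.first := by
  rintro ⟨e, b⟩ ⟨e', b'⟩ h
  have he : e = e' := by
    have := congrArg (fun d => d.1.1) h
    simpa only [first_fst_fst] using this
  subst he
  have hne : D.fwd (D.firstIndex e) ≠ D.bwd (D.lastIndex e) := by
    intro h
    have h1 : D.firstIndex e = D.lastIndex e := congrArg Prod.fst h
    rw [h1] at h
    exact D.fwd_ne_bwd _ h
  cases b <;> cases b' <;> simp_all [first]

lemma toDart_edge (a : G.edgeSet × Bool) : (D.toDart a).edge = a.1 := by
  unfold toDart; split_ifs <;> simp [D.dart_edge]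

lemma toDart_bijective : Function.Bijective D.toDart := by
  constructor
  · rintro ⟨e, b⟩ ⟨e', b'⟩ h
    have he : e = e' := by
      have := congrArg SimpleGraph.Dart.edge h
      rw [toDart_edge, toDart_edge] at this
      exact Subtype.ext this
    subst he
    have := (D.dart e).symm_ne
    cases b <;> cases b'
    · rfl
    · exact absurd h this
    · exact absurd h.symm this
    · rfl
  · intro d
    have := D.dart_edge ⟨d.edge, d.edge_mem⟩
    rcases SimpleGraph.dart_edge_eq_iff .. |>.1 this with h | h
    · exact ⟨(⟨d.edge, d.edge_mem⟩, true), h⟩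
    · exact ⟨(⟨d.edge, d.edge_mem⟩, false), by simp [toDart, h]⟩

lemma toDart_not (e : G.edgeSet) (b : Bool) : D.toDart (e, !b) = (D.toDart (e, b)).symm := by
  cases b <;> simp [toDart]

/-- A polyline meets vertices only at its ends, so the directed segments starting at a vertex are
exactly the initial segments of darts. Hence the cyclic order of segments at a vertex is one of
darts. -/
lemma exists_eq_first {d : D.Index × Bool} {v : V} (h : D.segments.start d = D.pos v) :
    ∃ a, D.first a = d := by
  obtain ⟨⟨e, k⟩, b⟩ := d
  rcases D.eq_fwd_or_eq_bwd (⟨e, k⟩, b) with h' | h' <;> rw [h'] at h ⊢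
  · rw [start_fwd] at h
    refine ⟨(e, true), ?_⟩
    have h0 : k.1 = 0 := by
      rcases D.eq_zero_or_eq_n e k v k.2.le h with h | h
      · exact h
      · exact absurd h k.2.ne
    simp only [first, if_true, firstIndex]
    congr 2
    exact Fin.ext h0.symm
  · rw [start_bwd] at h
    refine ⟨(e, false), ?_⟩
    have h0 : k.1 + 1 = D.n e := by
      rcases D.eq_zero_or_eq_n e (k + 1) v k.2 h with h | h
      · omega
      · exact h
    have hk : (⟨D.n e - 1, Nat.sub_lt (D.n_pos e) one_pos⟩ : Fin (D.n e)) = k :=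
      Fin.ext (by simp only; omega)
    simp [first, lastIndex, hk]

end PolylineDrawing

lemma sum_range_add_succ (g : ℕ → ZMod 2) (n : ℕ) :
    ∑ i ∈ Finset.range n, (g i + g (i + 1)) = g 0 + g n := by
  induction n with
  | zero => simp [CharTwo.add_self_eq_zero]
  | succ n ih =>
    rw [Finset.sum_range_succ, ih]
    have := CharTwo.add_self_eq_zero (g n)
    linear_combination this

namespace PolylineDrawing

variable {V : Type*} {G : SimpleGraph V} (D : PolylineDrawing G)

/-- The weights of the straight segments of a drawing of a graph with weighted edges. -/
def weight (w : Sym2 V → ZMod 2) (i : D.Index) : ZMod 2 := w i.1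

open Classical in
-- Along each edge the contributions of bends cancel in pairs, leaving the two ends; so evenness at
-- the vertices gives evenness at all points.
lemma even_weight [Fintype G.Dart] [Fintype G.edgeSet] {w : Sym2 V → ZMod 2}
    (hw : ∀ v, (∑ d : G.Dart, if d.fst = v then w d.edge else 0) = 0) :
    D.segments.Even (D.weight w) := by
  intro p
  have h1 : ∀ j : D.Index, ((if D.segments.l j = p then D.weight w j else 0) +
      if D.segments.r j = p then D.weight w j else 0) =
      (if D.x j.1 j.2 = p then w j.1 else 0) + if D.x j.1 (j.2 + 1) = p then w j.1 else 0 := by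
    intro j
    simp only [segments, leftEnd, rightEnd, src, tgt, weight]
    by_cases h : D.toRight j = true <;> simp [h, add_comm]
  have h2 : ∀ e : G.edgeSet, (∑ k : Fin (D.n e), ((if D.x e k = p then w e else 0) +
      if D.x e (k + 1) = p then w e else 0)) = ∑ b : Bool,
        if D.pos (D.toDart (e, b)).fst = p then w (D.toDart (e, b)).edge else 0 := by
    intro e
    rw [Fin.sum_univ_eq_sum_range (fun k => (if D.x e k = p then w e else 0) +
      if D.x e (k + 1) = p then w e else 0), sum_range_add_succ (fun k => if D.x e k = p then
        w e else 0)]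
    rw [Fintype.sum_bool, D.toDart_edge, D.toDart_edge, D.x_zero, D.x_n]
    rfl
  rw [← Finset.sum_add_distrib, Finset.sum_congr rfl fun j _ => h1 j, Fintype.sum_sigma,
    Finset.sum_congr rfl fun e _ => h2 e,
    ← Fintype.sum_prod_type (fun a : G.edgeSet × Bool => if D.pos (D.toDart a).fst = p then
      w (D.toDart a).edge else 0),
    Fintype.sum_bijective D.toDart D.toDart_bijective _
      (fun d => if D.pos d.fst = p then w d.edge else 0) (fun a => rfl)]
  by_cases hp : ∃ v, D.pos v = p
  · obtain ⟨v, rfl⟩ := hp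
    simpa only [D.pos_injective.eq_iff] using hw v
  · exact Finset.sum_eq_zero fun d _ => if_neg fun h => hp ⟨_, h⟩

lemma side_fwd_add_side_bwd [Fintype D.Index] (w : D.Index → ZMod 2) (i : D.Index) :
    D.segments.side w (D.fwd i) + D.segments.side w (D.bwd i) = w i := by
  have := CharTwo.add_self_eq_zero (D.segments.leftCount w i)
  simp only [SegmentSystem.side, fwd, bwd]
  by_cases h : D.toRight i = true <;> simp [h] <;> linear_combination this

lemma start_eq_bend {e : G.edgeSet} {k : ℕ} (h : k + 1 < D.n e) (d : D.Index × Bool) :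
    D.segments.start d = D.x e (k + 1) ↔
      d = D.bwd ⟨e, ⟨k, by omega⟩⟩ ∨ d = D.fwd ⟨e, ⟨k + 1, h⟩⟩ := by
  constructor
  · intro hd
    obtain ⟨⟨e', ⟨k', hk'⟩⟩, b⟩ := d
    rcases D.eq_fwd_or_eq_bwd (⟨e', ⟨k', hk'⟩⟩, b) with h' | h' <;> rw [h'] at hd ⊢
    · rw [start_fwd] at hd
      obtain ⟨rfl, hk⟩ := D.bend e (k + 1) e' k' h.le hk'.le (by omega) h hd.symm
      subst hk
      exact Or.inr rfl
    · rw [start_bwd] at hd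
      obtain ⟨rfl, hk⟩ := D.bend e (k + 1) e' (k' + 1) h.le hk' (by omega) h hd.symm
      obtain rfl : k = k' := by omega
      exact Or.inl rfl
  · rintro (rfl | rfl)
    · rw [start_bwd]; rfl
    · rw [start_fwd]; rfl

/-- At a bend only two directed segments start: the incoming one reversed and the outgoing one.
Their sides differ by `w e` in either cyclic order, and reversing the incoming one also changes its
side by `w e`, so the left side is kept. -/
lemma side_fwd_succ [Fintype D.Index] {w : Sym2 V → ZMod 2} (hw : D.segments.Even (D.weight w))
    {e : G.edgeSet} {k : ℕ} (h : k + 1 < D.n e) :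
    D.segments.side (D.weight w) (D.fwd ⟨e, ⟨k + 1, h⟩⟩) =
      D.segments.side (D.weight w) (D.fwd ⟨e, ⟨k, by omega⟩⟩) := by
  classical
  have hadd := D.side_fwd_add_side_bwd (D.weight w) ⟨e, ⟨k, by omega⟩⟩
  set a := D.bwd ⟨e, ⟨k, by omega⟩⟩ with ha
  set b := D.fwd ⟨e, ⟨k + 1, h⟩⟩ with hb
  have hab : a ≠ b := by
    intro hab
    have h' : (⟨e, ⟨k, by omega⟩⟩ : D.Index) = ⟨e, ⟨k + 1, h⟩⟩ := congrArg Prod.fst hab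
    simp at h'
  have hsa : D.segments.start a = D.x e (k + 1) := (D.start_eq_bend h a).2 (Or.inl rfl)
  have hsb : D.segments.start b = D.x e (k + 1) := (D.start_eq_bend h b).2 (Or.inr rfl)
  have hsum : ∀ c : D.Index × Bool, (∑ d', if D.segments.start d' = D.x e (k + 1) ∧
      D.segments.key d' ≤ D.segments.key c then D.weight w d'.1 else 0) =
      (if D.segments.key a ≤ D.segments.key c then w e else 0) +
        if D.segments.key b ≤ D.segments.key c then w e else 0 := by
    intro c
    rw [← Finset.sum_pair (f := fun d => if D.segments.key d ≤ D.segments.key c then w e else 0)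
      hab]
    rw [← Finset.sum_filter, ← Finset.sum_filter, Finset.sum_congr]
    · ext d
      simp [start_eq_bend D h, ← ha, ← hb]
    · intro d hd
      simp only [Finset.mem_filter, Finset.mem_insert, Finset.mem_singleton] at hd
      rcases hd.1 with rfl | rfl <;> rfl
  have h1 := D.segments.side_eq hw a
  have h2 := D.segments.side_eq hw b
  rw [hsa, hsum] at h1
  rw [hsb, hsum] at h2
  have hk : D.segments.key a ≠ D.segments.key b := fun hk =>
    hab (D.segments.key_injective (hsa.trans hsb.symm) hk)
  have hz : w e + w e = 0 := CharTwo.add_self_eq_zero _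
  have hw' : D.weight w ⟨e, ⟨k, by omega⟩⟩ = w e := rfl
  rw [hw'] at hadd
  have hss := CharTwo.add_self_eq_zero (D.segments.side (D.weight w) a)
  have key : D.segments.side (D.weight w) b = D.segments.side (D.weight w) a + w e := by
    rcases lt_or_gt_of_ne hk with hlt | hlt
    · rw [h1, h2]
      simp [hlt.le, not_le.2 hlt]
      ring
    · rw [h1, h2]
      simp [hlt.le, not_le.2 hlt]
      linear_combination hz
  rw [key]
  linear_combination hss - hadd

lemma side_first_add [Fintype D.Index] {w : Sym2 V → ZMod 2} (hw : D.segments.Even (D.weight w))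
    (e : G.edgeSet) :
    D.segments.side (D.weight w) (D.first (e, true)) +
      D.segments.side (D.weight w) (D.first (e, false)) = w e := by
  have h : ∀ k (hk : k < D.n e), D.segments.side (D.weight w) (D.fwd ⟨e, ⟨k, hk⟩⟩) =
      D.segments.side (D.weight w) (D.fwd (D.firstIndex e)) := by
    intro k
    induction k with
    | zero => intro hk; rfl
    | succ k ih => intro hk; rw [D.side_fwd_succ hw, ih]
  have := D.side_fwd_add_side_bwd (D.weight w) (D.lastIndex e)
  simp only [first, if_true, ← h _ (Nat.sub_lt (D.n_pos e) one_pos)]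
  exact this

end PolylineDrawing

/-! ### The rotation system of a planar graph -/

open Classical in
/-- A planar graph has a rotation system for which every even edge weight is a sum of face
boundaries. -/
theorem IsPlanar.exists_rotation {V : Type*} [Finite V] {G : SimpleGraph V} [Fintype G.Dart]
    (hG : IsPlanar G) : ∃ rot : Equiv.Perm G.Dart, (∀ d, (rot d).fst = d.fst) ∧
      (∀ d d' : G.Dart, d.fst = d'.fst → rot.SameCycle d d') ∧
      ∀ w : Sym2 V → ZMod 2, (∀ v, (∑ d : G.Dart, if d.fst = v then w d.edge else 0) = 0) →
        ∃ s : G.Dart → ZMod 2, (∀ d, s d + s d.symm = w d.edge) ∧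
          ∀ d, s (rot d) = s d + w (rot d).edge := by
  obtain ⟨D⟩ := hG.exists_polylineDrawing
  have : Fintype G.edgeSet := Fintype.ofFinite _
  let E : G.edgeSet × Bool ≃ G.Dart := Equiv.ofBijective _ D.toDart_bijective
  let f : G.Dart → D.Index × Bool := fun d => D.first (E.symm d)
  have hf : ∀ d, D.segments.start (f d) = D.pos d.fst := by
    intro d
    have : D.toDart (E.symm d) = d := E.apply_symm_apply d
    simp only [f, D.start_first, this]
  have hfe : ∀ d, ((f d).1.1 : Sym2 V) = d.edge := by
    intro d
    have : D.toDart (E.symm d) = d := E.apply_symm_apply d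
    simp only [f, D.first_fst_fst]
    rw [← D.toDart_edge, this]
  have hfinj : Function.Injective f := D.first_injective.comp E.symm.injective
  obtain ⟨rot, h1, h2, h3⟩ := exists_cyclic_succ (fun d : G.Dart => d.fst)
    (fun d => D.segments.key (f d)) (fun d d' h hk => hfinj
      (D.segments.key_injective (by rw [hf, hf, h]) hk))
  refine ⟨rot, h1, h2, fun w hw => ⟨fun d => D.segments.side (D.weight w) (f d), ?_, ?_⟩⟩
  · have he := D.even_weight hw
    intro d
    obtain ⟨⟨e, b⟩, rfl⟩ := E.surjective d
    have hs : (E (e, b)).symm = E (e, !b) := (D.toDart_not e b).symm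
    have hed : (E (e, b)).edge = e := D.toDart_edge (e, b)
    rw [hed, hs, ← D.side_first_add he e]
    simp only [f, Equiv.symm_apply_apply]
    cases b
    · exact add_comm _ _
    · rfl
  · have he := D.even_weight hw
    -- The first two terms depend only on the vertex, so one step of `rot` changes just the partial
    -- sum.
    have hcum : ∀ d, D.segments.side (D.weight w) (f d) =
        D.segments.pointCount (D.weight w) (D.pos d.fst) +
          D.segments.rightDegree (D.weight w) (D.pos d.fst) + ∑ d' : G.Dart,
          if d'.fst = d.fst ∧ D.segments.key (f d') ≤ D.segments.key (f d)
            then w d'.edge else 0 := by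
      intro d
      rw [D.segments.side_eq he, hf]
      congr 1
      symm
      refine Fintype.sum_of_injective f hfinj _ _ (fun d' hd' => if_neg ?_) (fun d' => ?_)
      · rintro ⟨h, -⟩
        obtain ⟨a, ha⟩ := D.exists_eq_first h
        exact hd' ⟨E a, by simp [f, ha]⟩
      · simp only [hf, D.pos_injective.eq_iff]
        congr 1
        rw [PolylineDrawing.weight, hfe]
    intro d
    change D.segments.side _ (f (rot d)) = D.segments.side _ (f d) + _
    rw [hcum, hcum, h1]
    linear_combination h3 (fun d => w d.edge) hw d

/-! ### Counting orbits, and Euler's inequality -/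

lemma Equiv.Perm.minimalPeriod_pos {D : Type*} [Finite D] (f : Equiv.Perm D) (d : D) :
    0 < Function.minimalPeriod f d :=
  Function.minimalPeriod_pos_of_mem_periodicPts (Function.Injective.mem_periodicPts f.injective d)

open Classical in
lemma card_fiber_eq_minimalPeriod {D X : Type*} [Fintype D] (f : Equiv.Perm D) (π : D → X)
    (h : ∀ d d', π d = π d' ↔ f.SameCycle d d') (d : D) :
    (Finset.univ.filter (fun d' => π d' = π d)).card = Function.minimalPeriod f d := by
  have himg : Finset.univ.filter (fun d' => π d' = π d) =
      (Finset.range (Function.minimalPeriod f d)).image (fun k => f^[k] d) := by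
    ext d'
    simp only [Finset.mem_filter, Finset.mem_univ, true_and, Finset.mem_image, Finset.mem_range]
    rw [eq_comm, h]
    constructor
    · intro hs
      obtain ⟨k, rfl⟩ := hs.exists_nat_pow_eq
      exact ⟨k % Function.minimalPeriod f d, Nat.mod_lt _ (f.minimalPeriod_pos d), by
        rw [Function.iterate_mod_minimalPeriod_eq, Equiv.Perm.iterate_eq_pow]⟩
    · rintro ⟨k, -, rfl⟩
      exact ⟨k, by rw [Equiv.Perm.iterate_eq_pow]; simp⟩
  rw [himg, Finset.card_image_of_injOn, Finset.card_range]
  intro a ha b hb hab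
  exact Function.iterate_injOn_Iio_minimalPeriod (by simpa using ha) (by simpa using hb) hab

/-- Each orbit contributes 1. This turns sums over darts into numbers of vertices and faces. -/
lemma sum_inv_minimalPeriod {D X : Type*} [Fintype D] [Fintype X] (f : Equiv.Perm D) (π : D → X)
    (hπ : Function.Surjective π) (h : ∀ d d', π d = π d' ↔ f.SameCycle d d') :
    ∑ d, (1 / Function.minimalPeriod f d : ℚ) = Fintype.card X := by
  classical
  rw [← Finset.sum_fiberwise (g := π)]
  have : ∀ x, ∑ d with π d = x, (1 / Function.minimalPeriod f d : ℚ) = 1 := by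
    intro x
    obtain ⟨d, rfl⟩ := hπ x
    have hpos := f.minimalPeriod_pos d
    have hcard := card_fiber_eq_minimalPeriod f π h d
    rw [Finset.sum_congr rfl (g := fun _ => (1 / Function.minimalPeriod f d : ℚ)),
      Finset.sum_const, hcard, nsmul_eq_mul]
    · have : (Function.minimalPeriod f d : ℚ) ≠ 0 := by positivity
      field_simp
    · intro d' hd'
      rw [← card_fiber_eq_minimalPeriod f π h d', (Finset.mem_filter.1 hd').2, hcard]
  rw [Finset.sum_congr rfl fun x _ => this x]
  simp

section Euler

variable {V : Type*} {G : SimpleGraph V}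

/-- The reversal of darts as a permutation. -/
def SimpleGraph.dartSymm (G : SimpleGraph V) : Equiv.Perm G.Dart :=
  Function.Involutive.toPerm _ SimpleGraph.Dart.symm_involutive

@[simp] lemma SimpleGraph.dartSymm_apply (d : G.Dart) : G.dartSymm d = d.symm := rfl

open Classical in
/-- Euler's inequality for a rotation system for which every even edge weight is a sum of face
boundaries. -/
theorem euler_inequality [Fintype V] [Nonempty V] [Fintype G.Dart] [Nonempty G.Dart] [Fintype G.edgeSet]
    (rot : Equiv.Perm G.Dart)
    (hrot : ∀ w : Sym2 V → ZMod 2, (∀ v, (∑ d : G.Dart, if d.fst = v then w d.edge else 0) = 0) →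
        ∃ s : G.Dart → ZMod 2, (∀ d, s d + s d.symm = w d.edge) ∧
          ∀ d, s (rot d) = s d + w (rot d).edge) :
    Fintype.card G.edgeSet + 2 ≤ Fintype.card V +
      Nat.card (Quotient (Equiv.Perm.SameCycle.setoid (rot⁻¹ * G.dartSymm))) := by
  let Q := Quotient (Equiv.Perm.SameCycle.setoid (rot⁻¹ * G.dartSymm))
  have : Fintype Q := Fintype.ofFinite _
  let mk : G.Dart → Q := Quotient.mk _
  let bd : (G.edgeSet → ZMod 2) →ₗ[ZMod 2] (V → ZMod 2) := LinearMap.pi fun v =>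
    ∑ d : G.Dart, if d.fst = v then LinearMap.proj ⟨d.edge, d.edge_mem⟩ else 0
  have hbd : ∀ w v, bd w v = ∑ d : G.Dart, if d.fst = v then w ⟨d.edge, d.edge_mem⟩ else 0 := by
    intro w v
    simp only [bd, LinearMap.pi_apply, LinearMap.sum_apply]
    refine Finset.sum_congr rfl fun d _ => ?_
    split_ifs <;> rfl
  let tot : (V → ZMod 2) →ₗ[ZMod 2] ZMod 2 := ∑ v, LinearMap.proj v
  have htot : ∀ f, tot f = ∑ v, f v := fun f => by simp [tot]
  let B : (Q → ZMod 2) →ₗ[ZMod 2] (G.Dart → ZMod 2) := LinearMap.pi fun d : G.Dart =>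
    LinearMap.proj (R := ZMod 2) (φ := fun _ : Q => ZMod 2) (mk d) +
      LinearMap.proj (R := ZMod 2) (φ := fun _ : Q => ZMod 2) (mk d.symm)
  let C : (G.edgeSet → ZMod 2) →ₗ[ZMod 2] (G.Dart → ZMod 2) := LinearMap.pi fun d : G.Dart =>
    LinearMap.proj (R := ZMod 2) (φ := fun _ : G.edgeSet => ZMod 2) ⟨d.edge, d.edge_mem⟩
  have hC : Function.Injective C := by
    intro w w' h
    ext ⟨e, he⟩
    induction e with
    | h u v => exact congrFun h ⟨(u, v), he⟩
  have hle : (LinearMap.ker bd).map C ≤ LinearMap.range B := by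
    rintro _ ⟨w, hw, rfl⟩
    have hw : bd w = 0 := hw
    let w' : Sym2 V → ZMod 2 := fun e => if h : e ∈ G.edgeSet then w ⟨e, h⟩ else 0
    have hw' : ∀ d : G.Dart, w' d.edge = w ⟨d.edge, d.edge_mem⟩ := fun d => dif_pos d.edge_mem
    obtain ⟨s, hs1, hs2⟩ := hrot w' (fun v => by
      simp only [hw', ← hbd, hw, Pi.zero_apply])
    -- Reversing `d` and rotating back by one step both change `s` by the weight of the same edge,
    -- so `s` is constant on faces.
    have hφ : ∀ d, s ((rot⁻¹ * G.dartSymm) d) = s d := by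
      intro d
      have h1 := hs2 (rot⁻¹ d.symm)
      have h2 := hs1 d
      have h0 : rot (rot⁻¹ d.symm) = d.symm := by simp
      rw [h0, SimpleGraph.Dart.edge_symm] at h1
      rw [Equiv.Perm.mul_apply, SimpleGraph.dartSymm_apply]
      have h4 := CharTwo.add_self_eq_zero (s d)
      linear_combination h2 - h1 - h4
    have hsc : ∀ a b, (Equiv.Perm.SameCycle.setoid (rot⁻¹ * G.dartSymm)).r a b → s a = s b := by
      intro a b hab
      obtain ⟨k, rfl⟩ := Equiv.Perm.SameCycle.exists_nat_pow_eq hab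
      induction k with
      | zero => rfl
      | succ k ih =>
        rw [pow_succ', Equiv.Perm.mul_apply, hφ]
        exact ih ⟨k, by simp⟩
    refine ⟨Quotient.lift s hsc, ?_⟩
    ext d
    exact (hs1 d).trans (hw' d)
  have h1 : Module.finrank (ZMod 2) (LinearMap.ker bd) ≤ Module.finrank (ZMod 2)
      (LinearMap.range B) :=
    (Submodule.equivMapOfInjective C hC _).finrank_eq.trans_le (Submodule.finrank_mono hle)
  have h2 := LinearMap.finrank_range_add_finrank_ker bd
  have h3 := LinearMap.finrank_range_add_finrank_ker B
  have h4 := LinearMap.finrank_range_add_finrank_ker tot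
  rw [Module.finrank_fintype_fun_eq_card] at h2 h3 h4
  rw [← Nat.card_eq_fintype_card] at h3
  change _ ≤ _ + Nat.card Q
  -- The boundary of an edge has total 0 because its two darts cancel; hence the rank of `bd` is at
  -- most `V - 1`.
  have h5 : Module.finrank (ZMod 2) (LinearMap.range bd) ≤
      Module.finrank (ZMod 2) (LinearMap.ker tot) := by
    refine Submodule.finrank_mono ?_
    rintro _ ⟨w, rfl⟩
    rw [LinearMap.mem_ker, htot]
    simp only [hbd]
    rw [Finset.sum_comm]
    simp only [Finset.sum_ite_eq, Finset.mem_univ, if_true]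
    refine Finset.sum_involution (fun d _ => d.symm) (fun d _ => ?_) (fun d _ _ => d.symm_ne)
      (fun d _ => Finset.mem_univ _) (fun d _ => d.symm_symm)
    simp only [SimpleGraph.Dart.edge_symm]
    exact CharTwo.add_self_eq_zero _
  have h6 : Module.finrank (ZMod 2) (LinearMap.range tot) = 1 := by
    rw [LinearMap.range_eq_top.2, finrank_top, Module.finrank_self]
    intro a
    obtain ⟨v⟩ := ‹Nonempty V›
    exact ⟨Pi.single v a, by simp [htot]⟩
  -- The sum of all face boundaries is 0, so face boundaries span dimension at most `F - 1`.
  have h7 : 1 ≤ Module.finrank (ZMod 2) (LinearMap.ker B) := by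
    rw [Submodule.one_le_finrank_iff]
    intro hbot
    have hmem : (fun _ => 1 : Q → ZMod 2) ∈ LinearMap.ker B := by
      rw [LinearMap.mem_ker]
      ext d
      exact CharTwo.add_self_eq_zero 1
    rw [hbot, Submodule.mem_bot] at hmem
    obtain ⟨d⟩ := ‹Nonempty G.Dart›
    exact one_ne_zero (congrFun hmem (mk d))
  omega

end Euler

/-! ### Averaging and two finite computations for the discharging -/

/-- Summing over all windows of `n` consecutive darts counts each dart `n` times. The window length
need not be related to the orbit lengths. -/
lemma sum_nonneg_of_sum_iterate_nonneg {D : Type*} [Fintype D] (f : Equiv.Perm D) {n : ℕ}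
    (hn : 0 < n) (g : D → ℚ) (h : ∀ d, 0 ≤ ∑ i ∈ Finset.range n, g (f^[i] d)) :
    0 ≤ ∑ d, g d := by
  have h1 : ∑ d, ∑ i ∈ Finset.range n, g (f^[i] d) = n * ∑ d, g d := by
    rw [Finset.sum_comm, Finset.sum_congr rfl (g := fun _ => ∑ d, g d)]
    · simp
    · intro i _
      rw [Equiv.Perm.iterate_eq_pow]
      exact Equiv.sum_comp (f ^ i) g
  have h2 : 0 ≤ ∑ d, ∑ i ∈ Finset.range n, g (f^[i] d) := Finset.sum_nonneg fun d _ => h d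
  rw [h1] at h2
  exact nonneg_of_mul_nonneg_right h2 (by exact_mod_cast hn)

set_option maxRecDepth 100000 in
/-- The final charge, multiplied by 30, of a face of length 5, where `b i` tells whether the
`i`-th edge lies on a triangle and `h i` whether the `i`-th vertex has degree at least 5. -/
lemma pentagon_charge_nonneg : ∀ b0 b1 b2 b3 b4 h0 h1 h2 h3 h4 : Bool,
    let K := b0.toNat + b1.toNat + b2.toNat + b3.toNat + b4.toNat
    let H := h0.toNat + h1.toNat + h2.toNat + h3.toNat + h4.toNat
    let C := bif H == 1 then 10 else 5
    -- Thirty times the payments across one edge `b`, with neighbouring edges `a`, `c` and ends `x`,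
    -- `y`. Below, 30 is the scaled initial charge `5 * (1 / 5)` and 10 the scaled 1/3 given to a
    -- triangle.
    let t := fun a b c x y : Bool => (bif b && Nat.ble 4 K && x then C else 0) +
      (bif b && Nat.ble 4 K && y then C else 0) + bif H == 0 && a && b && c then 5 else 0
    10 * K ≤ 30 + (t b4 b0 b1 h0 h1 + t b0 b1 b2 h1 h2 + t b1 b2 b3 h2 h3 + t b2 b3 b4 h3 h4 +
      t b3 b4 b0 h4 h0) := by
  decide

/-- The sum of the loads of the triangles around a vertex of degree 5. -/
lemma load_le_one {T0 T1 T2 T3 T4 : Prop} {p0 p1 p2 p3 p4 q0 q1 q2 q3 q4 o0 o1 o2 o3 o4 : ℚ}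
    (t0 : ¬ (T0 ∧ T1)) (t1 : ¬ (T1 ∧ T2)) (t2 : ¬ (T2 ∧ T3)) (t3 : ¬ (T3 ∧ T4))
    (t4 : ¬ (T4 ∧ T0))
    (z0 : ¬ T0 → p0 = 0 ∧ q0 = 0 ∧ o0 = 0) (z1 : ¬ T1 → p1 = 0 ∧ q1 = 0 ∧ o1 = 0)
    (z2 : ¬ T2 → p2 = 0 ∧ q2 = 0 ∧ o2 = 0) (z3 : ¬ T3 → p3 = 0 ∧ q3 = 0 ∧ o3 = 0)
    (z4 : ¬ T4 → p4 = 0 ∧ q4 = 0 ∧ o4 = 0)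
    (a0 : p0 + o0 ≤ 1 / 3) (a1 : p1 + o1 ≤ 1 / 3) (a2 : p2 + o2 ≤ 1 / 3) (a3 : p3 + o3 ≤ 1 / 3)
    (a4 : p4 + o4 ≤ 1 / 3) (c0 : q0 + o0 ≤ 1 / 3) (c1 : q1 + o1 ≤ 1 / 3) (c2 : q2 + o2 ≤ 1 / 3)
    (c3 : q3 + o3 ≤ 1 / 3) (c4 : q4 + o4 ≤ 1 / 3)
    (_n0 : 0 ≤ o0) (_n1 : 0 ≤ o1) (_n2 : 0 ≤ o2) (_n3 : 0 ≤ o3) (_n4 : 0 ≤ o4)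
    (e0 : p2 + q0 ≤ 1 / 3) (e1 : p3 + q1 ≤ 1 / 3) (e2 : p4 + q2 ≤ 1 / 3) (e3 : p0 + q3 ≤ 1 / 3)
    (e4 : p1 + q4 ≤ 1 / 3) :
    (p0 + q0 + o0) + (p1 + q1 + o1) + (p2 + q2 + o2) + (p3 + q3 + o3) + (p4 + q4 + o4) ≤ 1 := by
  -- At most two triangles remain. One alone has load at most 2/3. For two, the payments into the
  -- two faces between them on the longer side are bounded jointly by 1/3, and what remains of each
  -- load by 1/3.
  by_cases h0 : T0 <;> by_cases h1 : T1 <;> by_cases h2 : T2 <;> by_cases h3 : T3 <;>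
    by_cases h4 : T4 <;>
    first
    | (exfalso; apply t0; constructor <;> assumption)
    | (exfalso; apply t1; constructor <;> assumption)
    | (exfalso; apply t2; constructor <;> assumption)
    | (exfalso; apply t3; constructor <;> assumption)
    | (exfalso; apply t4; constructor <;> assumption)
    | (simp only [h0, h1, h2, h3, h4, not_false_eq_true, not_true_eq_false, true_implies,
        false_implies] at z0 z1 z2 z3 z4
       linarith)

/-! ### Combinatorial maps and the discharging rules -/

/-- A combinatorial map on a type of darts: the reversal of darts, and a permutation whose cycles
are the cyclic orders of the darts around the vertices. -/
structure CombinatorialMap (D : Type*) where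
  symm : Equiv.Perm D
  rot : Equiv.Perm D
  symm_symm : ∀ d, symm (symm d) = d

namespace CombinatorialMap

variable {D : Type*} (M : CombinatorialMap D)

/-- The next dart along a face. -/
def next : Equiv.Perm D := M.rot⁻¹ * M.symm

/-- The degree of the initial vertex of a dart. -/
noncomputable def deg (d : D) : ℕ := Function.minimalPeriod M.rot d

/-- The length of the face of a dart. -/
noncomputable def len (d : D) : ℕ := Function.minimalPeriod M.next d

/-- The previous dart along a face. -/
def prev (d : D) : D := M.symm (M.rot d)

lemma rot_next (d : D) : M.rot (M.next d) = M.symm d := by simp [next]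

lemma next_prev (d : D) : M.next (M.prev d) = d := by simp [next, prev, M.symm_symm]

lemma prev_next (d : D) : M.prev (M.next d) = d := by simp [prev, rot_next, M.symm_symm]

lemma symm_prev (d : D) : M.symm (M.prev d) = M.rot d := by simp [prev, M.symm_symm]

section Finite

variable [Finite D]

lemma deg_rot (d : D) : M.deg (M.rot d) = M.deg d :=
  Function.minimalPeriod_apply (Function.Injective.mem_periodicPts M.rot.injective d)

lemma len_next (d : D) : M.len (M.next d) = M.len d :=
  Function.minimalPeriod_apply (Function.Injective.mem_periodicPts M.next.injective d)

lemma len_prev (d : D) : M.len (M.prev d) = M.len d := by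
  rw [← M.len_next, next_prev]

lemma len_iterate (d : D) (i : ℕ) : M.len (M.next^[i] d) = M.len d := by
  induction i with
  | zero => rfl
  | succ i ih => rw [Function.iterate_succ_apply', len_next, ih]

lemma deg_next (d : D) : M.deg (M.next d) = M.deg (M.symm d) := by
  rw [← M.deg_rot, rot_next]

end Finite

lemma next_of_len {n : ℕ} {d : D} (h : M.len d = n) : M.next^[n] d = d := by
  rw [← h]; exact Function.iterate_minimalPeriod

lemma rot_of_deg {n : ℕ} {d : D} (h : M.deg d = n) : M.rot^[n] d = d := by
  rw [← h]; exact Function.iterate_minimalPeriod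

lemma next_five {d : D} (h : M.len d = 5) :
    M.next (M.next (M.next (M.next (M.next d)))) = d := M.next_of_len h

lemma next_three {d : D} (h : M.len d = 3) : M.next (M.next (M.next d)) = d := M.next_of_len h

lemma rot_four {d : D} (h : M.deg d = 4) : M.rot (M.rot (M.rot (M.rot d))) = d := M.rot_of_deg h

lemma rot_five {d : D} (h : M.deg d = 5) :
    M.rot (M.rot (M.rot (M.rot (M.rot d)))) = d := M.rot_of_deg h

/-- The initial vertex has degree at least 5. -/
def High (d : D) : Prop := 5 ≤ M.deg d

/-- The face on the other side is a triangle. -/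
def Tri (d : D) : Prop := M.len (M.symm d) = 3

open Classical in
/-- The truth value of `High`. -/
noncomputable def highBit (d : D) : Bool := decide (M.High d)

open Classical in
/-- The truth value of `Tri`. -/
noncomputable def triBit (d : D) : Bool := decide (M.Tri d)

lemma highBit_iff {d : D} : M.highBit d = true ↔ M.High d := by simp [highBit]

lemma triBit_iff {d : D} : M.triBit d = true ↔ M.Tri d := by simp [triBit]

/-- The number of vertices of degree at least 5 on a face of length 5. -/
noncomputable def numHigh (d : D) : ℕ := ∑ i ∈ Finset.range 5, (M.highBit (M.next^[i] d)).toNat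

/-- The number of triangles around a face of length 5. -/
noncomputable def numTri (d : D) : ℕ := ∑ i ∈ Finset.range 5, (M.triBit (M.next^[i] d)).toNat

lemma numHigh_eq (d : D) : M.numHigh d = (M.highBit d).toNat + (M.highBit (M.next d)).toNat +
    (M.highBit (M.next (M.next d))).toNat + (M.highBit (M.next (M.next (M.next d)))).toNat +
    (M.highBit (M.next (M.next (M.next (M.next d))))).toNat := by
  simp [numHigh, Finset.sum_range_succ]

lemma numTri_eq (d : D) : M.numTri d = (M.triBit d).toNat + (M.triBit (M.next d)).toNat +
    (M.triBit (M.next (M.next d))).toNat + (M.triBit (M.next (M.next (M.next d)))).toNat +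
    (M.triBit (M.next (M.next (M.next (M.next d))))).toNat := by
  simp [numTri, Finset.sum_range_succ]

lemma sum_five_next {A : Type*} [AddCommMonoid A] (g : D → A) {d : D} (h : M.len d = 5) :
    ∑ i ∈ Finset.range 5, g (M.next^[i] (M.next d)) = ∑ i ∈ Finset.range 5, g (M.next^[i] d) := by
  simp only [Finset.sum_range_succ, Finset.sum_range_zero, Function.iterate_succ,
    Function.iterate_zero, Function.comp, id, M.next_five h]
  abel

lemma numHigh_next {d : D} (h : M.len d = 5) : M.numHigh (M.next d) = M.numHigh d :=
  M.sum_five_next (fun d => (M.highBit d).toNat) h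

lemma numTri_next {d : D} (h : M.len d = 5) : M.numTri (M.next d) = M.numTri d :=
  M.sum_five_next (fun d => (M.triBit d).toNat) h

lemma prev_eq {d : D} (h : M.len d = 5) : M.prev d = M.next (M.next (M.next (M.next d))) := by
  rw [← M.next_five h, prev_next, M.next_five h]

lemma prev_eq_of_len_three {d : D} (h : M.len d = 3) : M.prev d = M.next (M.next d) := by
  rw [← M.next_three h, prev_next, M.next_three h]

lemma two_le_numHigh_of_next {d : D} (h0 : M.High d) (h1 : M.High (M.next d)) :
    2 ≤ M.numHigh d := by
  rw [numHigh_eq, M.highBit_iff.2 h0, M.highBit_iff.2 h1]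
  simp only [Bool.toNat_true]
  omega

lemma two_le_numHigh_of_next_next {d : D} (h0 : M.High d) (h1 : M.High (M.next (M.next d))) :
    2 ≤ M.numHigh d := by
  rw [numHigh_eq, M.highBit_iff.2 h0, M.highBit_iff.2 h1]
  simp only [Bool.toNat_true]
  omega

lemma not_high_of_numHigh_eq_zero [Finite D] {d : D} (hl : M.len d = 5) (h : M.numHigh d = 0)
    (i : ℕ) : ¬ M.High (M.next^[i] d) := by
  have : M.numHigh (M.next^[i] d) = 0 := by
    induction i with
    | zero => exact h
    | succ i ih =>
      rw [Function.iterate_succ_apply', M.numHigh_next (by rwa [len_iterate]), ih]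
  intro hi
  rw [numHigh_eq, M.highBit_iff.2 hi] at this
  simp at this

lemma tri_next_of_four_le {d : D} (h : 4 ≤ M.numTri d) (h0 : ¬ M.Tri d) : M.Tri (M.next d) := by
  by_contra h1
  rw [← triBit_iff, Bool.not_eq_true] at h0 h1
  rw [numTri_eq, h0, h1, Bool.toNat_false] at h
  have h2 := (M.triBit (M.next (M.next d))).toNat_le
  have h3 := (M.triBit (M.next (M.next (M.next d)))).toNat_le
  have h4 := (M.triBit (M.next (M.next (M.next (M.next d))))).toNat_le
  omega

lemma tri_prev_of_four_le {d : D} (hl : M.len d = 5) (h : 4 ≤ M.numTri d) (h0 : ¬ M.Tri d) :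
    M.Tri (M.prev d) := by
  by_contra h1
  rw [M.prev_eq hl] at h1
  rw [← triBit_iff, Bool.not_eq_true] at h0 h1
  rw [numTri_eq, h0, h1, Bool.toNat_false] at h
  have h2 := (M.triBit (M.next d)).toNat_le
  have h3 := (M.triBit (M.next (M.next d))).toNat_le
  have h4 := (M.triBit (M.next (M.next (M.next d)))).toNat_le
  omega

/-- The share of the deficit of a face of length 5 paid by a vertex of high degree. -/
noncomputable def share (d : D) : ℚ := if M.numHigh d = 1 then 1 / 3 else 1 / 6

open Classical in
/-- The charge sent to the face of a dart by its initial vertex. -/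
noncomputable def payStart (d : D) : ℚ :=
  if M.len d = 5 ∧ M.Tri d ∧ 4 ≤ M.numTri d ∧ M.High d then M.share d else 0

open Classical in
/-- The charge sent to the face of a dart by its final vertex. -/
noncomputable def payEnd (d : D) : ℚ :=
  if M.len d = 5 ∧ M.Tri d ∧ 4 ≤ M.numTri d ∧ M.High (M.next d) then M.share d else 0

open Classical in
/-- The charge sent to the face of a dart by the vertex of the adjacent triangle that is opposite
to the dart. -/
noncomputable def payApex (d : D) : ℚ :=
  if M.len d = 5 ∧ M.numHigh d = 0 ∧ M.Tri (M.prev d) ∧ M.Tri d ∧ M.Tri (M.next d) then 1 / 6 else 0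

lemma share_nonneg (d : D) : 0 ≤ M.share d := by unfold share; split_ifs <;> norm_num

lemma share_le (d : D) : M.share d ≤ 1 / 3 := by unfold share; split_ifs <;> norm_num

lemma share_of_two_le {d : D} (h : 2 ≤ M.numHigh d) : M.share d = 1 / 6 := by
  unfold share; rw [if_neg (by omega)]

lemma payStart_nonneg (d : D) : 0 ≤ M.payStart d := by
  unfold payStart; split_ifs; exacts [M.share_nonneg d, le_rfl]

lemma payEnd_nonneg (d : D) : 0 ≤ M.payEnd d := by
  unfold payEnd; split_ifs; exacts [M.share_nonneg d, le_rfl]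

lemma payApex_nonneg (d : D) : 0 ≤ M.payApex d := by
  unfold payApex; split_ifs <;> norm_num

lemma payStart_le (d : D) : M.payStart d ≤ 1 / 3 := by
  unfold payStart; split_ifs; exacts [M.share_le d, by norm_num]

lemma payEnd_le (d : D) : M.payEnd d ≤ 1 / 3 := by
  unfold payEnd; split_ifs; exacts [M.share_le d, by norm_num]

lemma payApex_le (d : D) : M.payApex d ≤ 1 / 6 := by
  unfold payApex; split_ifs <;> norm_num

/-- The final charge of a dart on the side of its face. -/
noncomputable def faceCharge (d : D) : ℚ :=
  1 - 4 / M.len d + (if M.len d = 3 then 1 / 3 else 0) - (if M.len (M.symm d) = 3 then 1 / 3 else 0) +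
    M.payStart d + M.payEnd d + M.payApex d

/-- The charge sent away by the initial vertex of a dart through the triangle on its left. -/
noncomputable def load (d : D) : ℚ :=
  M.payStart (M.rot d) + M.payEnd (M.symm d) + M.payApex (M.symm (M.next d))

/-- The hypotheses of the discharging argument: all degrees are at least 4, no triangle is
adjacent to a face of length 3 or 4, and no triangle with three vertices of degree 4 is adjacent
to a face of length 5 with five vertices of degree 4. -/
structure Reduced : Prop where
  four_le_deg : ∀ d, 4 ≤ M.deg d
  three_le_len : ∀ d, 3 ≤ M.len d
  five_le_len : ∀ d, M.len d = 3 → 5 ≤ M.len (M.symm d)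
  high_apex : ∀ d, M.len d = 5 → M.Tri d → (∀ i, M.deg (M.next^[i] d) = 4) →
    M.High (M.next (M.next (M.symm d)))

end CombinatorialMap

/-! ### Bounds on the charge sent by a vertex -/

namespace CombinatorialMap

variable {D : Type*} {M : CombinatorialMap D}

lemma payStart_le_of {d : D} (h : M.len d = 5 → 2 ≤ M.numHigh d) : M.payStart d ≤ 1 / 6 := by
  unfold payStart
  split_ifs with h'
  · rw [M.share_of_two_le (h h'.1)]
  · norm_num

lemma payEnd_le_of {d : D} (h : M.len d = 5 → 2 ≤ M.numHigh d) : M.payEnd d ≤ 1 / 6 := by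
  unfold payEnd
  split_ifs with h'
  · rw [M.share_of_two_le (h h'.1)]
  · norm_num

lemma high_congr {d d' : D} (h : M.deg d = M.deg d') (hd : M.High d) : M.High d' := by
  unfold High at *; omega

namespace Reduced

lemma deg_eq_four (hM : M.Reduced) {d : D} (h : ¬ M.High d) : M.deg d = 4 := by
  have := hM.four_le_deg d
  unfold High at h
  omega

lemma payEnd_symm_eq_zero {d : D} (h : M.len d ≠ 3) : M.payEnd (M.symm d) = 0 := by
  unfold payEnd
  refine if_neg fun h' => h ?_
  have := h'.2.1
  rwa [Tri, M.symm_symm] at this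

variable [Finite D]

lemma not_len_rot (hM : M.Reduced) {d : D} (h : M.len d = 3) : M.len (M.rot d) ≠ 3 := by
  intro h'
  have := hM.five_le_len (M.rot d) h'
  have h2 : M.len (M.symm (M.rot d)) = M.len d := M.len_prev d
  omega

lemma payStart_rot_eq_zero {d : D} (h : M.len d ≠ 3) : M.payStart (M.rot d) = 0 := by
  unfold payStart
  refine if_neg fun h' => h ?_
  rw [← M.len_prev]
  exact h'.2.1

lemma payApex_symm_next_eq_zero {d : D} (h : M.len d ≠ 3) : M.payApex (M.symm (M.next d)) = 0 := by
  unfold payApex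
  refine if_neg fun h' => h ?_
  have := h'.2.2.2.1
  rwa [Tri, M.symm_symm, M.len_next] at this

/-- The paid pentagon has only vertices of degree 4 and three consecutive triangles, whose apices
all have degree at least 5. The two other faces next to the middle triangle each contain its apex
and that of a neighbouring triangle, so they receive only the smaller share if they are pentagons.
-/
lemma apex (hM : M.Reduced) {d : D} (h : M.payApex (M.symm (M.next d)) ≠ 0) :
    M.High d ∧ M.payStart (M.rot d) ≤ 1 / 6 ∧ M.payEnd (M.symm d) ≤ 1 / 6 := by
  have h3 : M.len d = 3 := by
    by_contra h3
    exact h (payApex_symm_next_eq_zero h3)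
  obtain ⟨x, hx⟩ : ∃ x, x = M.symm (M.next d) := ⟨_, rfl⟩
  rw [← hx] at h
  have hsx : M.symm x = M.next d := by rw [hx, M.symm_symm]
  obtain ⟨hl, hn, ht1, ht2, ht3⟩ : M.len x = 5 ∧ M.numHigh x = 0 ∧ M.Tri (M.prev x) ∧ M.Tri x ∧
      M.Tri (M.next x) := by
    by_contra h'
    exact h (if_neg h')
  have h4 : ∀ i, M.deg (M.next^[i] x) = 4 := fun i =>
    hM.deg_eq_four (M.not_high_of_numHigh_eq_zero hl hn i)
  have h4' : ∀ i, M.deg (M.next^[i] (M.next x)) = 4 := fun i => h4 (i + 1)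
  have h4'' : ∀ i, M.deg (M.next^[i] (M.prev x)) = 4 := by
    intro i
    rw [M.prev_eq hl]
    have := h4 (i + 4)
    rwa [Function.iterate_add_apply] at this
  have a1 := hM.high_apex x hl ht2 h4
  have a2 := hM.high_apex (M.next x) (by rw [M.len_next, hl]) ht3 h4'
  have a3 := hM.high_apex (M.prev x) (by rw [M.len_prev, hl]) ht1 h4''
  rw [hsx, M.next_three h3] at a1
  refine ⟨a1, payStart_le_of fun hy => ?_, payEnd_le_of fun hy => ?_⟩
  · refine M.two_le_numHigh_of_next_next (high_congr (M.deg_rot d).symm a1) ?_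
    -- The start of `x` has degree 4, so exactly one face lies between the triangle of `d` and the
    -- triangle of `u` there; it is the face of `rot d`.
    obtain ⟨u, hu⟩ : ∃ u, u = M.symm (M.prev x) := ⟨_, rfl⟩
    have hu3 : M.len u = 3 := by rw [hu]; exact ht1
    have e1 : M.rot x = u := by rw [hu, M.symm_prev]
    have e2 : M.rot (M.next (M.next d)) = x := by rw [M.rot_next, hx]
    have e3 : M.rot u = M.symm (M.next (M.next u)) := by
      rw [← M.symm_prev, M.prev_eq_of_len_three hu3]
    have hd2 : M.deg (M.next (M.next d)) = 4 := by
      rw [← M.deg_rot, e2]; exact h4 0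
    have e4 : M.rot (M.next (M.rot d)) = M.next (M.next d) := by
      rw [M.rot_next, ← M.prev_eq_of_len_three h3]; rfl
    have e5 : M.next (M.rot d) = M.symm (M.next (M.next u)) := by
      apply M.rot.injective
      rw [e4, ← e3, ← e1, ← e2, M.rot_four hd2]
    rw [← hu] at a3
    rw [e5]
    refine high_congr ?_ a3
    rw [M.deg_next (M.symm _), M.symm_symm]
  -- The mirror image, at the other end of `x`.
  · have hn1 : M.deg (M.next x) = 4 := h4 1
    have hw : M.deg (M.next (M.symm (M.next x))) = 4 := by rw [M.deg_next, M.symm_symm, hn1]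
    have e1 := M.rot_four hw
    rw [M.rot_next, M.symm_symm, M.rot_next, hsx, M.rot_next] at e1
    rw [← M.next_prev (M.symm d), M.numHigh_next (by rw [M.len_prev, hy])]
    refine M.two_le_numHigh_of_next_next ?_ ?_
    · refine high_congr ?_ a2
      rw [prev, e1, ← M.deg_next]
    · rw [M.next_prev]
      refine high_congr ?_ a1
      rw [M.deg_next, M.symm_symm]

lemma load_eq_zero {d : D} (h : M.len d ≠ 3) : M.load d = 0 := by
  rw [load, payStart_rot_eq_zero h, payEnd_symm_eq_zero h, payApex_symm_next_eq_zero h]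
  norm_num

lemma payStart_add_payApex_le (hM : M.Reduced) (d : D) :
    M.payStart (M.rot d) + M.payApex (M.symm (M.next d)) ≤ 1 / 3 := by
  by_cases h : M.payApex (M.symm (M.next d)) = 0
  · have := M.payStart_le (M.rot d); linarith
  · have := (hM.apex h).2.1
    have := M.payApex_le (M.symm (M.next d))
    linarith

lemma payEnd_add_payApex_le (hM : M.Reduced) (d : D) :
    M.payEnd (M.symm d) + M.payApex (M.symm (M.next d)) ≤ 1 / 3 := by
  by_cases h : M.payApex (M.symm (M.next d)) = 0
  · have := M.payEnd_le (M.symm d); linarith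
  · have := (hM.apex h).2.2
    have := M.payApex_le (M.symm (M.next d))
    linarith

lemma load_le (hM : M.Reduced) (d : D) : M.load d ≤ 2 / 3 := by
  have h1 := hM.payStart_add_payApex_le d
  have h2 := hM.payEnd_add_payApex_le d
  have h3 := M.payApex_nonneg (M.symm (M.next d))
  unfold load
  linarith

lemma load_eq_zero_of_not_high (hM : M.Reduced) {d : D} (h : ¬ M.High d) : M.load d = 0 := by
  have h1 : M.payStart (M.rot d) = 0 :=
    if_neg fun h' => h (high_congr (M.deg_rot d) h'.2.2.2)
  have h2 : M.payEnd (M.symm d) = 0 :=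
    if_neg fun h' => h (high_congr (by rw [M.deg_next, M.symm_symm]) h'.2.2.2)
  have h3 : M.payApex (M.symm (M.next d)) = 0 := by
    by_contra h3
    exact h (hM.apex h3).1
  rw [load, h1, h2, h3]
  norm_num

/-- Two consecutive faces of length 5 around a vertex, each adjacent to four triangles, share a
further vertex of degree at least 5. -/
lemma payStart_add_payEnd_le (hM : M.Reduced) {e f : D} (hf : M.rot f = e) :
    M.payStart f + M.payEnd (M.symm (M.rot e)) ≤ 1 / 3 := by
  by_cases h1 : M.payStart f = 0
  · have := M.payEnd_le (M.symm (M.rot e)); linarith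
  by_cases h2 : M.payEnd (M.symm (M.rot e)) = 0
  · have := M.payStart_le f; linarith
  obtain ⟨a1, -, a3, a4⟩ : M.len f = 5 ∧ M.Tri f ∧ 4 ≤ M.numTri f ∧ M.High f := by
    by_contra h'
    exact h1 (if_neg h')
  change ¬ M.payEnd (M.prev e) = 0 at h2
  obtain ⟨b1, -, b3, -⟩ : M.len (M.prev e) = 5 ∧ M.Tri (M.prev e) ∧ 4 ≤ M.numTri (M.prev e) ∧
      M.High (M.next (M.prev e)) := by
    by_contra h'
    exact h2 (if_neg h')
  have hpf : M.prev f = M.symm e := by rw [prev, hf]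
  have he : M.High e := high_congr (by rw [← hf, M.deg_rot]) a4
  have hle : M.len e = 5 := by rw [← b1, M.len_prev]
  have hls : M.len (M.symm e) = 5 := by rw [← hpf, M.len_prev, a1]
  have hnf : M.next (M.symm e) = f := by rw [← hpf, M.next_prev]
  rw [← M.numTri_next b1, M.next_prev] at b3
  rw [← hnf, M.numTri_next hls] at a3
  -- The common edge of the two pentagons is not triangular, so their edges next to it are.
  have t1 : M.Tri (M.next e) := M.tri_next_of_four_le b3 (by rw [Tri, hls]; norm_num)
  have t2 : M.Tri (M.prev (M.symm e)) :=
    M.tri_prev_of_four_le hls a3 (by rw [Tri, M.symm_symm, hle]; norm_num)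
  rw [Tri, M.symm_prev] at t2
  -- If the far end of the common edge had degree 4, the two triangles beyond it would be
  -- consecutive around that end, hence adjacent.
  have hs : M.High (M.symm e) := by
    by_contra hs
    have hr := M.rot_four (hM.deg_eq_four hs)
    refine hM.not_len_rot t2 ?_
    have e1 : M.rot (M.rot (M.rot (M.symm e))) = M.next e := by
      apply M.rot.injective
      rw [hr, M.rot_next]
    have e2 := M.len_prev (M.rot (M.rot (M.symm e)))
    rw [prev, e1] at e2
    rw [← e2]
    exact t1
  have hne : M.High (M.next e) := high_congr (M.deg_next e).symm hs
  have h6 : M.payStart f ≤ 1 / 6 := by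
    refine payStart_le_of fun _ => ?_
    rw [← hnf, M.numHigh_next hls]
    exact M.two_le_numHigh_of_next hs (hnf ▸ a4)
  have h7 : M.payEnd (M.prev e) ≤ 1 / 6 := by
    refine payEnd_le_of fun _ => ?_
    rw [← M.numHigh_next b1, M.next_prev]
    exact M.two_le_numHigh_of_next he hne
  change _ + M.payEnd (M.prev e) ≤ _
  linarith

lemma sum_load_le_one (hM : M.Reduced) {d : D} (h : M.deg d = 5) :
    ∑ i ∈ Finset.range 5, M.load (M.rot^[i] d) ≤ 1 := by
  have h5 := M.rot_five h
  have hT : ∀ d, ¬ (M.len d = 3 ∧ M.len (M.rot d) = 3) := fun d h => hM.not_len_rot h.1 h.2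
  have hz : ∀ d, ¬ M.len d = 3 → M.payStart (M.rot d) = 0 ∧ M.payEnd (M.symm d) = 0 ∧
      M.payApex (M.symm (M.next d)) = 0 := fun d h =>
    ⟨payStart_rot_eq_zero h, payEnd_symm_eq_zero h, payApex_symm_next_eq_zero h⟩
  have ha := hM.payStart_add_payApex_le
  have hc := hM.payEnd_add_payApex_le
  have hn := fun d => M.payApex_nonneg (M.symm (M.next d))
  have he : ∀ d, M.payStart (M.rot d) + M.payEnd (M.symm (M.rot (M.rot (M.rot d)))) ≤ 1 / 3 :=
    fun d => hM.payStart_add_payEnd_le rfl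
  simp only [Finset.sum_range_succ, Finset.sum_range_zero, Function.iterate_succ,
    Function.iterate_zero, Function.comp, id, zero_add, load]
  set d1 := M.rot d with h1
  set d2 := M.rot d1 with h2
  set d3 := M.rot d2 with h3
  set d4 := M.rot d3 with h4
  have t4 := hT d4
  have e2 := he d2
  have e3 := he d3
  have e4 := he d4
  rw [h5] at t4
  rw [← h3, ← h4, h5] at e2
  rw [← h4, h5, ← h1] at e3
  rw [h5, ← h1, ← h2] at e4
  exact load_le_one (hT d) (hT d1) (hT d2) (hT d3) t4 (hz d) (hz d1) (hz d2) (hz d3) (hz d4)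
    (ha d) (ha d1) (ha d2) (ha d3) (ha d4) (hc d) (hc d1) (hc d2) (hc d3) (hc d4)
    (hn d) (hn d1) (hn d2) (hn d3) (hn d4) e2 e3 (h5.symm ▸ e4) (he d) (he d1)

end Reduced

end CombinatorialMap

/-! ### Final charges are nonnegative -/

namespace CombinatorialMap

lemma cast_cond {b : Bool} {P : Prop} [Decidable P] (h : b = true ↔ P) (a : ℕ) :
    ((bif b then a else 0 : ℕ) : ℚ) = if P then (a : ℚ) else 0 := by
  cases b
  · rw [if_neg (by simp [← h])]; simp
  · rw [if_pos (h.1 rfl)]; rfl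

namespace Reduced

variable {D : Type*} {M : CombinatorialMap D}

lemma sum_faceCharge_nonneg_of_len_five [Finite D] {d : D} (h : M.len d = 5) :
    0 ≤ ∑ i ∈ Finset.range 5, M.faceCharge (M.next^[i] d) := by
  have h5 := M.next_five h
  -- The factor 30 clears all denominators and brings the charge into the form of
  -- `pentagon_charge_nonneg`.
  have key : ∀ x, M.len x = 5 → M.numHigh x = M.numHigh d → M.numTri x = M.numTri d →
      30 * M.faceCharge x = 6 - 10 * ((M.triBit x).toNat : ℚ) +
      (((bif M.triBit x && Nat.ble 4 (M.numTri d) && M.highBit x then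
          (bif M.numHigh d == 1 then 10 else 5) else 0) +
        (bif M.triBit x && Nat.ble 4 (M.numTri d) && M.highBit (M.next x) then
          (bif M.numHigh d == 1 then 10 else 5) else 0) +
        bif M.numHigh d == 0 && M.triBit (M.prev x) && M.triBit x && M.triBit (M.next x)
          then 5 else 0 : ℕ) : ℚ) := by
    intro x hx hH hT
    classical
    have e1 : (if M.len (M.symm x) = 3 then (1 / 3 : ℚ) else 0) = (M.triBit x).toNat / 3 := by
      have : M.triBit x = true ↔ M.len (M.symm x) = 3 := M.triBit_iff
      cases hb : M.triBit x <;> simp_all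
    have e2 : 30 * M.share x = ((bif M.numHigh d == 1 then 10 else 5 : ℕ) : ℚ) := by
      rw [share, hH, cond_eq_ite]
      by_cases h1 : M.numHigh d = 1 <;> simp [h1] <;> norm_num
    have e3 : 30 * M.payStart x = ((bif M.triBit x && Nat.ble 4 (M.numTri d) && M.highBit x then
          (bif M.numHigh d == 1 then 10 else 5) else 0 : ℕ) : ℚ) := by
      rw [payStart, cast_cond (P := M.len x = 5 ∧ M.Tri x ∧ 4 ≤ M.numTri x ∧ M.High x)
        (by rw [Bool.and_eq_true, Bool.and_eq_true, triBit_iff, highBit_iff, Nat.ble_eq, hT]; tauto)]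
      split_ifs
      · exact e2
      · simp
    have e4 : 30 * M.payEnd x = ((bif M.triBit x && Nat.ble 4 (M.numTri d) && M.highBit (M.next x)
          then (bif M.numHigh d == 1 then 10 else 5) else 0 : ℕ) : ℚ) := by
      rw [payEnd, cast_cond (P := M.len x = 5 ∧ M.Tri x ∧ 4 ≤ M.numTri x ∧ M.High (M.next x))
        (by rw [Bool.and_eq_true, Bool.and_eq_true, triBit_iff, highBit_iff, Nat.ble_eq, hT]; tauto)]
      split_ifs
      · exact e2
      · simp
    have e5 : 30 * M.payApex x = ((bif M.numHigh d == 0 && M.triBit (M.prev x) && M.triBit x &&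
          M.triBit (M.next x) then 5 else 0 : ℕ) : ℚ) := by
      rw [payApex, cast_cond (P := M.len x = 5 ∧ M.numHigh x = 0 ∧ M.Tri (M.prev x) ∧ M.Tri x ∧
        M.Tri (M.next x)) (by
          rw [Bool.and_eq_true, Bool.and_eq_true, Bool.and_eq_true, triBit_iff, triBit_iff,
            triBit_iff, beq_iff_eq, hH]; tauto)]
      split_ifs <;> norm_num
    have e6 : M.faceCharge x = 1 / 5 - (M.triBit x).toNat / 3 + M.payStart x + M.payEnd x +
        M.payApex x := by
      rw [faceCharge, e1, hx]
      norm_num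
    rw [e6]
    push_cast
    linear_combination e3 + e4 + e5
  have hl := fun x => M.len_next x
  have hh : ∀ x, M.len x = 5 → _ := fun x hx => M.numHigh_next hx
  have ht : ∀ x, M.len x = 5 → _ := fun x hx => M.numTri_next hx
  simp only [Finset.sum_range_succ, Finset.sum_range_zero, Function.iterate_succ,
    Function.iterate_zero, Function.comp, id, zero_add]
  set d1 := M.next d with hd1
  set d2 := M.next d1 with hd2
  set d3 := M.next d2 with hd3
  set d4 := M.next d3 with hd4
  have l1 : M.len d1 = 5 := by rw [hd1, hl, h]
  have l2 : M.len d2 = 5 := by rw [hd2, hl, l1]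
  have l3 : M.len d3 = 5 := by rw [hd3, hl, l2]
  have l4 : M.len d4 = 5 := by rw [hd4, hl, l3]
  have k0 := key d h rfl rfl
  have k1 := key d1 l1 (by rw [hd1, hh d h]) (by rw [hd1, ht d h])
  have k2 := key d2 l2 (by rw [hd2, hh d1 l1, hd1, hh d h]) (by rw [hd2, ht d1 l1, hd1, ht d h])
  have k3 := key d3 l3 (by rw [hd3, hh d2 l2, hd2, hh d1 l1, hd1, hh d h])
    (by rw [hd3, ht d2 l2, hd2, ht d1 l1, hd1, ht d h])
  have k4 := key d4 l4 (by rw [hd4, hh d3 l3, hd3, hh d2 l2, hd2, hh d1 l1, hd1, hh d h])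
    (by rw [hd4, ht d3 l3, hd3, ht d2 l2, hd2, ht d1 l1, hd1, ht d h])
  have p0 : M.prev d = d4 := by rw [← h5, M.prev_next]
  have p1 : M.prev d1 = d := M.prev_next d
  have p2 : M.prev d2 = d1 := M.prev_next d1
  have p3 : M.prev d3 = d2 := M.prev_next d2
  have p4 : M.prev d4 = d3 := M.prev_next d3
  rw [p0, ← hd1] at k0
  rw [p1, ← hd2] at k1
  rw [p2, ← hd3] at k2
  rw [p3, ← hd4] at k3
  rw [p4, h5] at k4
  have hp := pentagon_charge_nonneg (M.triBit d) (M.triBit d1) (M.triBit d2) (M.triBit d3)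
    (M.triBit d4) (M.highBit d) (M.highBit d1) (M.highBit d2) (M.highBit d3) (M.highBit d4)
  have hK := M.numTri_eq d
  have hH := M.numHigh_eq d
  rw [← hd1, ← hd2, ← hd3, ← hd4] at hK hH
  simp only at hp
  rw [← hK, ← hH] at hp
  have hp' := (Nat.cast_le (α := ℚ)).2 hp
  have hK' := congrArg (Nat.cast (R := ℚ)) hK
  push_cast at hp' hK' k0 k1 k2 k3 k4
  linarith

/-- Here single darts suffice: a face of length at least 6 has `1 - 4 / 6 = 1 / 3` per dart, enough
for a triangle, a triangle is filled up to 0, and a face of length 4 gives nothing. -/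
lemma faceCharge_nonneg_of_len_ne_five [Finite D] (hM : M.Reduced) {d : D} (h : M.len d ≠ 5) :
    0 ≤ M.faceCharge d := by
  have h1 := M.payStart_nonneg d
  have h2 := M.payEnd_nonneg d
  have h3 := M.payApex_nonneg d
  unfold faceCharge
  have h4 := hM.three_le_len d
  by_cases ht : M.len (M.symm d) = 3
  · have h5 := hM.five_le_len (M.symm d) ht
    rw [M.symm_symm] at h5
    have h6 : 6 ≤ M.len d := by omega
    have h7 : (6 : ℚ) ≤ M.len d := by exact_mod_cast h6
    have h8 : (4 : ℚ) / M.len d ≤ 2 / 3 := by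
      rw [div_le_div_iff₀ (by linarith) (by norm_num)]; linarith
    rw [if_neg (by omega), if_pos ht]
    linarith
  · rw [if_neg ht]
    by_cases h3' : M.len d = 3
    · rw [if_pos h3', h3']
      norm_num
      linarith
    · have h6 : 4 ≤ M.len d := by omega
      have h7 : (4 : ℚ) ≤ M.len d := by exact_mod_cast h6
      have h8 : (4 : ℚ) / M.len d ≤ 1 := by
        rw [div_le_one (by linarith)]; exact h7
      rw [if_neg h3']
      linarith

lemma sum_faceCharge_nonneg [Fintype D] (hM : M.Reduced) : 0 ≤ ∑ d, M.faceCharge d := by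
  refine sum_nonneg_of_sum_iterate_nonneg M.next (n := 5) (by norm_num) _ fun d => ?_
  by_cases h : M.len d = 5
  · exact sum_faceCharge_nonneg_of_len_five h
  · exact Finset.sum_nonneg fun i _ =>
      hM.faceCharge_nonneg_of_len_ne_five (by rwa [M.len_iterate])

lemma deg_iterate [Finite D] (d : D) (i : ℕ) : M.deg (M.rot^[i] d) = M.deg d := by
  induction i with
  | zero => rfl
  | succ i ih => rw [Function.iterate_succ_apply', M.deg_rot, ih]

lemma sum_vertexCharge_nonneg [Fintype D] (hM : M.Reduced) :
    0 ≤ ∑ d, (1 - 4 / (M.deg d : ℚ) - M.load d) := by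
  have hsplit : ∀ d, (1 - 4 / (M.deg d : ℚ) - M.load d) =
      (if M.deg d = 5 then 1 / 5 - M.load d else 0) +
        if M.deg d = 5 then 0 else 1 - 4 / (M.deg d : ℚ) - M.load d := by
    intro d
    split_ifs with h
    · rw [h]; norm_num
    · ring
  rw [Finset.sum_congr rfl fun d _ => hsplit d, Finset.sum_add_distrib]
  refine add_nonneg ?_ ?_
  -- A full turn around a vertex of degree 5, whose initial charge is 1.
  · refine sum_nonneg_of_sum_iterate_nonneg M.rot (n := 5) (by norm_num) _ fun d => ?_
    simp only [deg_iterate]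
    by_cases h : M.deg d = 5
    · have := hM.sum_load_le_one h
      simp only [if_pos h, Finset.sum_sub_distrib, Finset.sum_const, Finset.card_range]
      norm_num
      linarith
    · simp [h]
  -- Of two consecutive faces at most one is a triangle, with load at most 2/3; two darts at a
  -- vertex of degree at least 6 carry at least that much.
  · refine sum_nonneg_of_sum_iterate_nonneg M.rot (n := 2) (by norm_num) _ fun d => ?_
    simp only [deg_iterate]
    by_cases h : M.deg d = 5
    · simp [h]
    simp only [if_neg h, Finset.sum_range_succ, Finset.sum_range_zero, Function.iterate_succ,
      Function.iterate_zero, Function.comp, id]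
    by_cases hh : M.High d
    · have h6 : 6 ≤ M.deg d := by unfold High at hh; omega
      have h7 : (6 : ℚ) ≤ M.deg d := by exact_mod_cast h6
      have h8 : (4 : ℚ) / M.deg d ≤ 2 / 3 := by
        rw [div_le_div_iff₀ (by linarith) (by norm_num)]; linarith
      have h9 : M.load d + M.load (M.rot d) ≤ 2 / 3 := by
        by_cases h3 : M.len d = 3
        · rw [load_eq_zero (hM.not_len_rot h3)]
          have := hM.load_le d
          linarith
        · rw [load_eq_zero h3]
          have := hM.load_le (M.rot d)
          linarith
      linarith
    · rw [hM.load_eq_zero_of_not_high hh, hM.load_eq_zero_of_not_high (d := M.rot d)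
        (fun h' => hh (high_congr (M.deg_rot d) h')), hM.deg_eq_four hh]
      norm_num

/-- The discharging argument. -/
theorem sum_charge_nonneg [Fintype D] (hM : M.Reduced) :
    0 ≤ ∑ d, (1 - 4 / (M.deg d : ℚ)) + ∑ d, (1 - 4 / (M.len d : ℚ)) := by
  have h1 := hM.sum_faceCharge_nonneg
  have h2 := hM.sum_vertexCharge_nonneg
  -- Reindexing by permutations of the darts: what vertices send equals what faces receive.
  have e1 : ∑ d, M.load d = ∑ d, M.payStart d + ∑ d, M.payEnd d + ∑ d, M.payApex d := by
    simp only [load, Finset.sum_add_distrib]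
    rw [Equiv.sum_comp M.rot, Equiv.sum_comp M.symm,
      Equiv.sum_comp (M.next.trans M.symm) M.payApex |>.symm]
    rfl
  have e2 : ∑ d, (if M.len (M.symm d) = 3 then (1 / 3 : ℚ) else 0) = ∑ d, if M.len d = 3 then 1 / 3 else 0 :=
    Equiv.sum_comp M.symm (fun d => if M.len d = 3 then (1 / 3 : ℚ) else 0)
  simp only [faceCharge, Finset.sum_add_distrib, Finset.sum_sub_distrib] at h1 h2
  simp only [Finset.sum_sub_distrib]
  rw [e1] at h2
  linarith

end Reduced

end CombinatorialMap

/-! ### Triangular 4-cycles, induced subgraphs and light pairs -/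

/-- No 4-cycle `a b c d` has an edge `a b` in a triangle `a b t`. -/
def SimpleGraph.NoTriangularFourCycle {V : Type*} (G : SimpleGraph V) : Prop :=
  ∀ a b c d t, G.Adj a b → G.Adj b c → G.Adj c d → G.Adj d a → a ≠ c → b ≠ d → G.Adj a t →
    G.Adj b t → False

lemma NoFourCycleAdjacentToTriangle.noTriangularFourCycle {V : Type*} {G : SimpleGraph V}
    (h : NoFourCycleAdjacentToTriangle G) : G.NoTriangularFourCycle := by
  intro a b c d t hab hbc hcd hda hac hbd hat hbt
  refine h a (.cons hab (.cons hbc (.cons hcd (.cons hda .nil)))) a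
    (.cons hab (.cons hbt (.cons hat.symm .nil))) ?_ rfl ?_ rfl s(a, b) (by simp) (by simp)
  · have := hab.ne; have := hbc.ne; have := hcd.ne; have := hda.ne
    simp [SimpleGraph.Walk.cons_isCycle_iff]
    grind
  · have := hab.ne; have := hbt.ne; have := hat.ne
    simp [SimpleGraph.Walk.cons_isCycle_iff]
    grind

lemma SimpleGraph.NoTriangularFourCycle.induce {V : Type*} {G : SimpleGraph V}
    (h : G.NoTriangularFourCycle) (s : Set V) : (G.induce s).NoTriangularFourCycle := by
  intro a b c d t hab hbc hcd hda hac hbd hat hbt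
  exact h a b c d t hab hbc hcd hda (fun e => hac (Subtype.ext e)) (fun e => hbd (Subtype.ext e))
    hat hbt

lemma IsPlanar.induce {V : Type*} {G : SimpleGraph V} (h : IsPlanar G) (s : Set V) :
    IsPlanar (G.induce s) := by
  obtain ⟨D⟩ := h
  have hmem : ∀ e ∈ (G.induce s).edgeSet, e.map Subtype.val ∈ G.edgeSet := by
    intro e he
    induction e with
    | h u v => exact he
  refine ⟨{ pos := fun v => D.pos v, arc := fun e => D.arc (e.map Subtype.val)
            pos_injective := D.pos_injective.comp Subtype.val_injective
            isPolygonalArc_arc := fun u v huv => D.isPolygonalArc_arc u v huv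
            mem_of_pos_mem_arc := ?_, arc_inter_arc := ?_ }⟩
  · intro e he w hw
    obtain ⟨w', hw', hww⟩ := Sym2.mem_map.1 (D.mem_of_pos_mem_arc _ (hmem e he) w hw)
    rwa [← Subtype.ext hww]
  · intro e he e' he' hne z hz hz'
    obtain ⟨w, hw, hw', rfl⟩ := D.arc_inter_arc _ (hmem e he) _ (hmem e' he')
      (fun h => hne (Sym2.map.injective Subtype.val_injective h)) z hz hz'
    obtain ⟨w1, h1, rfl⟩ := Sym2.mem_map.1 hw
    obtain ⟨w2, h2, h3⟩ := Sym2.mem_map.1 hw'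
    exact ⟨w1, h1, Subtype.ext h3 ▸ h2, rfl⟩

/-- A 5-cycle `a b c d e` and a triangle `a b x` all of whose vertices have degree 4. -/
structure LightPair {V : Type*} [Fintype V] (G : SimpleGraph V) [DecidableRel G.Adj]
    (a b c d e x : V) : Prop where
  ab : G.Adj a b
  bc : G.Adj b c
  cd : G.Adj c d
  de : G.Adj d e
  ea : G.Adj e a
  ax : G.Adj a x
  bx : G.Adj b x
  ac : a ≠ c
  bd : b ≠ d
  ce : c ≠ e
  da : d ≠ a
  eb : e ≠ b
  deg_a : G.degree a = 4
  deg_b : G.degree b = 4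
  deg_c : G.degree c = 4
  deg_d : G.degree d = 4
  deg_e : G.degree e = 4
  deg_x : G.degree x = 4

/-! ### Faces of the rotation system, and existence of a light pair -/

section RotationSystem

variable {V : Type*} {G : SimpleGraph V}

/-- The combinatorial map of a rotation system of a graph. -/
def SimpleGraph.toMap (G : SimpleGraph V) (rot : Equiv.Perm G.Dart) : CombinatorialMap G.Dart where
  symm := G.dartSymm
  rot := rot
  symm_symm d := d.symm_symm

variable {rot : Equiv.Perm G.Dart}

lemma next_fst (hfst : ∀ d, (rot d).fst = d.fst) (d : G.Dart) :
    ((G.toMap rot).next d).fst = d.snd := by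
  rw [← hfst]
  change ((G.toMap rot).rot _).fst = _
  rw [CombinatorialMap.rot_next]
  rfl

/-- A face turns back along an edge only at a vertex of degree 1. -/
lemma next_snd_ne (hfst : ∀ d, (rot d).fst = d.fst) (hdeg : ∀ d, 4 ≤ (G.toMap rot).deg d)
    (d : G.Dart) : ((G.toMap rot).next d).snd ≠ d.fst := by
  intro h
  have h1 : (G.toMap rot).next d = d.symm :=
    SimpleGraph.Dart.ext _ _ (Prod.ext (next_fst hfst d) h)
  have h2 := (G.toMap rot).rot_next d
  rw [h1] at h2
  have h3 := hdeg d.symm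
  have h4 : (G.toMap rot).deg d.symm = 1 := Function.minimalPeriod_eq_one_iff_isFixedPt.2 h2
  omega

lemma three_le_len [Finite G.Dart] (hfst : ∀ d, (rot d).fst = d.fst)
    (hdeg : ∀ d, 4 ≤ (G.toMap rot).deg d) (d : G.Dart) : 3 ≤ (G.toMap rot).len d := by
  have h0 : 0 < (G.toMap rot).len d := Equiv.Perm.minimalPeriod_pos _ d
  have h1 : (G.toMap rot).len d ≠ 1 := by
    intro h
    have h := (G.toMap rot).next_of_len h
    have h2 := next_fst hfst d
    rw [Function.iterate_one] at h
    rw [h] at h2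
    exact d.adj.ne h2
  have h2 : (G.toMap rot).len d ≠ 2 := by
    intro h
    have h : (G.toMap rot).next ((G.toMap rot).next d) = d := (G.toMap rot).next_of_len h
    have h2 := next_fst hfst ((G.toMap rot).next d)
    rw [h] at h2
    exact next_snd_ne hfst hdeg d h2.symm
  omega

lemma adj_next (hfst : ∀ d, (rot d).fst = d.fst) (d : G.Dart) :
    G.Adj d.fst ((G.toMap rot).next d).fst := by
  rw [next_fst hfst]; exact d.adj

lemma fst_next_next_ne (hfst : ∀ d, (rot d).fst = d.fst) (hdeg : ∀ d, 4 ≤ (G.toMap rot).deg d)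
    (d : G.Dart) : d.fst ≠ ((G.toMap rot).next ((G.toMap rot).next d)).fst := by
  rw [next_fst hfst ((G.toMap rot).next d)]
  exact (next_snd_ne hfst hdeg d).symm

lemma five_le_len [Finite G.Dart] (hG : G.NoTriangularFourCycle) (hfst : ∀ d, (rot d).fst = d.fst)
    (hdeg : ∀ d, 4 ≤ (G.toMap rot).deg d) (d : G.Dart) (h3 : (G.toMap rot).len d = 3) :
    5 ≤ (G.toMap rot).len ((G.toMap rot).symm d) := by
  set M := G.toMap rot with hM
  have hge : 3 ≤ M.len (M.symm d) := three_le_len hfst hdeg _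
  have n3 := M.next_three h3
  have a0 : G.Adj d.fst (M.next d).fst := adj_next hfst d
  have a1 : G.Adj (M.next d).fst (M.next (M.next d)).fst := adj_next hfst _
  have a2 : G.Adj (M.next (M.next d)).fst d.fst := by
    have := adj_next hfst (M.next (M.next d))
    rwa [← hM, n3] at this
  have e0 : (M.symm d).fst = (M.next d).fst := (next_fst hfst d).symm
  have e1 : (M.next (M.symm d)).fst = d.fst := next_fst hfst (M.symm d)
  have b0 : G.Adj (M.next (M.symm d)).fst (M.next (M.next (M.symm d))).fst := adj_next hfst _
  have c0 := fst_next_next_ne hfst hdeg (M.symm d)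
  have c1 := fst_next_next_ne hfst hdeg (M.next (M.symm d))
  rw [← hM] at c0 c1
  rw [e1] at b0 c1
  have h3' : M.len (M.symm d) ≠ 3 := by
    intro h
    have m3 := M.next_three h
    have b1 : G.Adj (M.next (M.next (M.symm d))).fst (M.symm d).fst := by
      have := adj_next hfst (M.next (M.next (M.symm d)))
      rwa [← hM, m3] at this
    rw [e0] at b1
    -- Two triangular faces on one edge with the same third vertex would close up around an end,
    -- giving it degree at most 2. With different third vertices they form a 4-cycle having the
    -- common edge as a chord.
    by_cases hw : (M.next (M.next d)).fst = (M.next (M.next (M.symm d))).fst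
    · have h1 : M.next (M.symm d) = M.rot d := by
        have h2 : M.rot d = M.symm (M.next (M.next d)) := by
          rw [← M.prev_eq_of_len_three h3, M.symm_prev]
        rw [h2]
        refine SimpleGraph.Dart.ext _ _ (Prod.ext ?_ ?_)
        · rw [e1]
          have := next_fst hfst (M.next (M.next d))
          rw [← hM, n3] at this
          exact this
        · have := next_fst hfst (M.next (M.symm d))
          rw [← hM] at this
          exact this.symm.trans hw.symm
      have h2 : M.rot (M.rot d) = d := by
        rw [← h1, M.rot_next, M.symm_symm]
      have h4 : M.deg d ≤ 2 := Function.IsPeriodicPt.minimalPeriod_le (by norm_num) h2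
      have := hdeg d
      omega
    · exact hG _ _ _ _ (M.next d).fst a2.symm a1.symm b1.symm b0.symm a0.ne hw a0 a1.symm
  have h4' : M.len (M.symm d) ≠ 4 := by
    intro h
    have m4 : M.next (M.next (M.next (M.next (M.symm d)))) = M.symm d := M.next_of_len h
    have b1 : G.Adj (M.next (M.next (M.symm d))).fst (M.next (M.next (M.next (M.symm d)))).fst :=
      adj_next hfst _
    have b2 : G.Adj (M.next (M.next (M.next (M.symm d)))).fst (M.symm d).fst := by
      have := adj_next hfst (M.next (M.next (M.next (M.symm d))))
      rwa [← hM, m4] at this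
    rw [e0] at b2 c0
    exact hG _ _ _ _ (M.next (M.next d)).fst a0.symm b0 b1 b2 c0 c1 a1 a2.symm
  omega

open Classical in
/-- A planar graph of minimum degree at least 4 without triangular 4-cycles has a 5-cycle adjacent
to a triangle such that all their vertices have degree 4. -/
theorem IsPlanar.exists_lightPair [Fintype V] [Nonempty V] (hpl : IsPlanar G)
    (hG : G.NoTriangularFourCycle) (hmin : ∀ v, 4 ≤ G.degree v) :
    ∃ a b c d e x, LightPair G a b c d e x := by
  by_contra hcon
  obtain ⟨rot, hfst, hsame, hrot⟩ := hpl.exists_rotation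
  have hiff : ∀ d d' : G.Dart, d.fst = d'.fst ↔ rot.SameCycle d d' := by
    refine fun d d' => ⟨hsame d d', fun h => ?_⟩
    obtain ⟨k, rfl⟩ := h.exists_nat_pow_eq
    induction k with
    | zero => rfl
    | succ k ih => rw [pow_succ', Equiv.Perm.mul_apply, hfst]; exact ih ⟨k, by simp⟩
  set M := G.toMap rot with hM
  have hdegree : ∀ d, M.deg d = G.degree d.fst := by
    intro d
    rw [← G.dart_fst_fiber_card_eq_degree]
    exact (card_fiber_eq_minimalPeriod rot (fun d : G.Dart => d.fst) hiff d).symm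
  have hdeg : ∀ d, 4 ≤ M.deg d := fun d => by rw [hdegree]; exact hmin _
  have hred : M.Reduced := by
    refine ⟨hdeg, three_le_len hfst hdeg, five_le_len hG hfst hdeg, ?_⟩
    intro x hl ht h4
    by_contra hx
    refine hcon ⟨x.fst, (M.next x).fst, (M.next (M.next x)).fst, (M.next (M.next (M.next x))).fst,
      (M.next (M.next (M.next (M.next x)))).fst, (M.next (M.next (M.symm x))).fst, ?_⟩
    have n5 := M.next_five hl
    have n3 := M.next_three ht
    have hadj : ∀ d, G.Adj d.fst (M.next d).fst := adj_next hfst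
    have hne : ∀ d, d.fst ≠ (M.next (M.next d)).fst := fst_next_next_ne hfst hdeg
    have e0 : (M.symm x).fst = (M.next x).fst := (next_fst hfst x).symm
    have e1 : (M.next (M.symm x)).fst = x.fst := next_fst hfst (M.symm x)
    have hh : M.deg (M.next (M.next (M.symm x))) = 4 := by
      have := hdeg (M.next (M.next (M.symm x)))
      unfold CombinatorialMap.High at hx
      omega
    exact {
      ab := hadj _, bc := hadj _, cd := hadj _, de := hadj _
      ea := by simpa only [n5] using hadj (M.next (M.next (M.next (M.next x))))
      ax := e1 ▸ hadj (M.next (M.symm x))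
      bx := by
        have := hadj (M.next (M.next (M.symm x)))
        rw [n3, e0] at this
        exact this.symm
      -- In a closed walk of length 5 any two positions are one or two steps apart, so adjacency and
      -- the absence of backtracking make all vertices distinct.
      ac := hne _, bd := hne _, ce := hne _
      da := by simpa only [n5] using hne (M.next (M.next (M.next x)))
      eb := by simpa only [n5] using hne (M.next (M.next (M.next (M.next x))))
      deg_a := hdegree x ▸ h4 0
      deg_b := hdegree (M.next x) ▸ h4 1
      deg_c := hdegree (M.next (M.next x)) ▸ h4 2
      deg_d := hdegree (M.next (M.next (M.next x))) ▸ h4 3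
      deg_e := hdegree (M.next (M.next (M.next (M.next x)))) ▸ h4 4
      deg_x := hdegree (M.next (M.next (M.symm x))) ▸ hh }
  have hcharge := hred.sum_charge_nonneg
  have hsurj : Function.Surjective (fun d : G.Dart => d.fst) := by
    intro v
    have h1 : 0 < G.degree v := by have := hmin v; omega
    obtain ⟨w, hw⟩ := (G.degree_pos_iff_exists_adj v).1 h1
    exact ⟨⟨(v, w), hw⟩, rfl⟩
  have : Nonempty G.Dart := ⟨(hsurj (Classical.arbitrary V)).choose⟩
  have heuler := euler_inequality rot hrot
  rw [Nat.card_eq_fintype_card] at heuler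
  have hV := sum_inv_minimalPeriod rot (fun d : G.Dart => d.fst) hsurj hiff
  have hQ := sum_inv_minimalPeriod (rot⁻¹ * G.dartSymm)
    (Quotient.mk (Equiv.Perm.SameCycle.setoid (rot⁻¹ * G.dartSymm)))
    Quotient.mk_surjective (fun d d' => Quotient.eq)
  have hE : Fintype.card G.Dart = 2 * Fintype.card G.edgeSet := by
    rw [G.dart_card_eq_twice_card_edges, SimpleGraph.edgeFinset_card]
  have h1 : ∑ d, (1 - 4 / (M.deg d : ℚ)) = Fintype.card G.Dart - 4 * Fintype.card V := by
    rw [← hV, Finset.mul_sum, Finset.sum_sub_distrib]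
    simp [CombinatorialMap.deg, hM, SimpleGraph.toMap, div_eq_mul_inv]
  have h2 : ∑ d, (1 - 4 / (M.len d : ℚ)) = Fintype.card G.Dart - 4 *
      Fintype.card (Quotient (Equiv.Perm.SameCycle.setoid (rot⁻¹ * G.dartSymm))) := by
    rw [← hQ, Finset.mul_sum, Finset.sum_sub_distrib]
    simp [CombinatorialMap.len, CombinatorialMap.next, hM, SimpleGraph.toMap, div_eq_mul_inv]
  -- The total charge is `4E - 4V - 4F`, which Euler's inequality bounds by `-8`.
  rw [h1, h2, hE] at hcharge
  have h3 := (Nat.cast_le (α := ℚ)).2 heuler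
  push_cast at h3 hcharge
  linarith

end RotationSystem

/-! ### Signed list colouring by induction on vertex sets -/

section Coloring

variable {V : Type*} {G : SimpleGraph V}

open Classical in
/-- The sign of an edge, as an integer. -/
noncomputable def Signature.sign (σ : Signature G) (u v : V) : ℤ :=
  if h : G.Adj u v then σ ⟨s(u, v), h⟩ else 1

lemma Signature.sign_comm (σ : Signature G) (u v : V) : σ.sign u v = σ.sign v u := by
  unfold Signature.sign
  by_cases h : G.Adj u v
  · rw [dif_pos h, dif_pos h.symm]
    congr 3
    exact Sym2.eq_swap
  · rw [dif_neg h, dif_neg fun h' => h h'.symm]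

lemma Signature.sign_mul_self (σ : Signature G) (u v : V) : σ.sign u v * σ.sign u v = 1 := by
  unfold Signature.sign
  split_ifs with h
  · rw [← Units.val_mul, Int.units_mul_self]; rfl
  · rfl

/-- A sign is its own inverse, so conflict along an edge is a symmetric relation. -/
lemma Signature.eq_sign_mul_iff (σ : Signature G) (u v : V) (x y : ℤ) :
    x = σ.sign u v * y ↔ y = σ.sign v u * x := by
  have h := σ.sign_mul_self u v
  rw [σ.sign_comm v u]
  constructor
  · rintro rfl; rw [← mul_assoc, h, one_mul]
  · rintro rfl; rw [← mul_assoc, h, one_mul]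

/-- `f` is a coloring of the signed graph induced by `S` with colors from the lists `L`. -/
def IsPartialColoring (σ : Signature G) (L : V → Finset ℤ) (S : Finset V) (f : V → ℤ) : Prop :=
  (∀ v ∈ S, f v ∈ L v) ∧ ∀ u ∈ S, ∀ v ∈ S, G.Adj u v → f u ≠ σ.sign u v * f v

variable {σ : Signature G} {L : V → Finset ℤ} {S : Finset V} {f : V → ℤ}

lemma IsPartialColoring.update [DecidableEq V] (hf : IsPartialColoring σ L S f) {v : V}
    (hv : v ∉ S) {c : ℤ} (hc : c ∈ L v) (h : ∀ u ∈ S, G.Adj v u → c ≠ σ.sign v u * f u) :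
    IsPartialColoring σ L (insert v S) (Function.update f v c) := by
  have hne : ∀ u ∈ S, u ≠ v := fun u hu e => hv (e ▸ hu)
  constructor
  · intro u hu
    rcases Finset.mem_insert.1 hu with rfl | hu
    · rwa [Function.update_self]
    · rw [Function.update_of_ne (hne u hu)]; exact hf.1 u hu
  · intro u hu w hw huw
    rcases Finset.mem_insert.1 hu with hu' | hu' <;> rcases Finset.mem_insert.1 hw with hw' | hw'
    · exact absurd (hu'.trans hw'.symm) huw.ne
    · subst hu'
      rw [Function.update_self, Function.update_of_ne (hne w hw')]
      exact h w hw' huw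
    · subst hw'
      rw [Function.update_self, Function.update_of_ne (hne u hu'), Ne, σ.eq_sign_mul_iff]
      exact h u hu' huw.symm
    · rw [Function.update_of_ne (hne u hu'), Function.update_of_ne (hne w hw')]
      exact hf.2 u hu' w hw' huw

open Classical in
/-- The colors at `v` that are in conflict with the colors of the neighbors of `v` in `S`. -/
noncomputable def conflicts (σ : Signature G) (S : Finset V) (f : V → ℤ) (v : V) : Finset ℤ :=
  (S.filter (G.Adj v)).image fun u => σ.sign v u * f u

open Classical in
lemma card_conflicts_le : (conflicts σ S f v).card ≤ (S.filter (G.Adj v)).card :=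
  Finset.card_image_le

lemma ne_of_notMem_conflicts {v : V} {c : ℤ} (h : c ∉ conflicts σ S f v) :
    ∀ u ∈ S, G.Adj v u → c ≠ σ.sign v u * f u := by
  classical
  rintro u hu hvu rfl
  exact h (Finset.mem_image_of_mem _ (Finset.mem_filter.2 ⟨hu, hvu⟩))

open Classical in
lemma IsPartialColoring.exists_insert (hf : IsPartialColoring σ L S f) {v : V} (hv : v ∉ S)
    (hL : (S.filter (G.Adj v)).card < (L v).card) :
    ∃ c, IsPartialColoring σ L (insert v S) (Function.update f v c) := by
  obtain ⟨c, hc, hc'⟩ := Finset.exists_mem_notMem_of_card_lt_card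
    ((card_conflicts_le (σ := σ) (f := f)).trans_lt hL)
  exact ⟨c, hf.update hv hc (ne_of_notMem_conflicts hc')⟩

open Classical in
/-- A coloring of the complement of a 5-cycle adjacent to a triangle, all of whose vertices have
degree 4, can be extended. -/
lemma IsPartialColoring.exists_extend {a b c d e x : V} (hL : ∀ v, (L v).card = 4)
    (hS : ∀ v ∈ ({a, b, c, d, e, x} : Finset V), v ∈ S ∧ (S.filter (G.Adj v)).card ≤ 4)
    (hdis : [a, b, c, d, e, x].Nodup)
    (ab : G.Adj a b) (bc : G.Adj b c) (cd : G.Adj c d) (de : G.Adj d e) (ea : G.Adj e a)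
    (ax : G.Adj a x) (bx : G.Adj b x) (hxc : ¬ G.Adj x c) (hxd : ¬ G.Adj x d) (hxe : ¬ G.Adj x e)
    (hf : IsPartialColoring σ L (S \ {a, b, c, d, e, x}) f) :
    ∃ f, IsPartialColoring σ L S f := by
  simp only [List.nodup_cons, List.mem_cons, List.not_mem_nil, or_false, not_or, not_false_eq_true,
    List.nodup_nil, and_true] at hdis
  obtain ⟨⟨n1, n2, n3, n4, n5⟩, ⟨n6, n7, n8, n9⟩, ⟨n10, n11, n12⟩, ⟨n13, n14⟩, n15⟩ := hdis
  have ha := hS a (by simp)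
  have hb := hS b (by simp)
  have hc := hS c (by simp)
  have hd := hS d (by simp)
  have he := hS e (by simp)
  have hx := hS x (by simp)
  set S0 := S \ {a, b, c, d, e, x} with hS0
  have hmem : ∀ v, v ∈ S0 ↔ v ∈ S ∧ v ≠ a ∧ v ≠ b ∧ v ≠ c ∧ v ≠ d ∧ v ≠ e ∧ v ≠ x := by
    intro v; simp [hS0]
  -- neighbors outside a set of colored vertices
  have hcount : ∀ (T U : Finset V) (v : V), T ⊆ S → (∀ u ∈ U, u ∈ S ∧ u ∉ T ∧ G.Adj v u) →
      (S.filter (G.Adj v)).card ≤ 4 → (T.filter (G.Adj v)).card + U.card ≤ 4 := by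
    intro T U v hT hU hv
    rw [← Finset.card_union_of_disjoint]
    · refine (Finset.card_le_card ?_).trans hv
      intro u hu
      rcases Finset.mem_union.1 hu with hu | hu
      · exact Finset.mem_filter.2 ⟨hT (Finset.mem_filter.1 hu).1, (Finset.mem_filter.1 hu).2⟩
      · exact Finset.mem_filter.2 ⟨(hU u hu).1, (hU u hu).2.2⟩
    · rw [Finset.disjoint_left]
      exact fun u hu hu' => (hU u hu').2.1 (Finset.mem_filter.1 hu).1
  have hsub : S0 ⊆ S := Finset.sdiff_subset
  -- two colors for `x`
  have hx2 : 2 ≤ (L x \ conflicts σ S0 f x).card := by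
    have h1 := hcount S0 {a, b} x hsub (by
      intro u hu
      rcases Finset.mem_insert.1 hu with rfl | hu
      · exact ⟨ha.1, by simp [hmem], ax.symm⟩
      · obtain rfl := Finset.mem_singleton.1 hu
        exact ⟨hb.1, by simp [hmem], bx.symm⟩) hx.2
    rw [Finset.card_pair n1] at h1
    have h2 := Finset.le_card_sdiff (conflicts σ S0 f x) (L x)
    have h3 := card_conflicts_le (σ := σ) (S := S0) (f := f) (v := x)
    rw [hL] at h2
    omega
  obtain ⟨y1, hy1, y2, hy2, hy⟩ := Finset.one_lt_card.1 hx2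
  rw [Finset.mem_sdiff] at hy1 hy2
  -- a color for `a`
  have ha1 : (conflicts σ S0 f a ∪ {σ.sign a x * y1, σ.sign a x * y2}).card < (L a).card := by
    have h1 := hcount S0 {b, e, x} a hsub (by
      intro u hu
      simp only [Finset.mem_insert, Finset.mem_singleton] at hu
      rcases hu with rfl | rfl | rfl
      · exact ⟨hb.1, by simp [hmem], ab⟩
      · exact ⟨he.1, by simp [hmem], ea.symm⟩
      · exact ⟨hx.1, by simp [hmem], ax⟩) ha.2
    rw [Finset.card_eq_three.2 ⟨b, e, x, n8, n9, n15, rfl⟩] at h1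
    have h2 := Finset.card_union_le (conflicts σ S0 f a) {σ.sign a x * y1, σ.sign a x * y2}
    have h3 := card_conflicts_le (σ := σ) (S := S0) (f := f) (v := a)
    have h4 : ({σ.sign a x * y1, σ.sign a x * y2} : Finset ℤ).card ≤ 2 := Finset.card_le_two
    rw [hL]
    omega
  -- At most one neighbour of `a` is coloured, so at most three values are forbidden, including the
  -- two that would conflict with `y1` or `y2` at `x`.
  obtain ⟨ca, hca, hca'⟩ := Finset.exists_mem_notMem_of_card_lt_card ha1
  simp only [Finset.mem_union, Finset.mem_insert, Finset.mem_singleton, not_or] at hca'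
  have f1 := hf.update (by simp [hmem]) hca (ne_of_notMem_conflicts hca'.1)
  have step : ∀ (T : Finset V) (g : V → ℤ) (v u : V), IsPartialColoring σ L T g → T ⊆ S →
      (S.filter (G.Adj v)).card ≤ 4 → v ∉ T → u ∈ S → u ∉ T → G.Adj v u →
      ∃ k, IsPartialColoring σ L (insert v T) (Function.update g v k) := by
    intro T g v u hg hT hv hvT hu huT huv
    refine hg.exists_insert hvT ?_
    have := hcount T {u} v hT (by
      intro w hw
      obtain rfl := Finset.mem_singleton.1 hw
      exact ⟨hu, huT, huv⟩) hv
    rw [Finset.card_singleton] at this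
    rw [hL]
    omega
  have s1 : insert a S0 ⊆ S := Finset.insert_subset ha.1 hsub
  obtain ⟨ce, f2⟩ := step _ _ e d f1 s1 he.2 (by simp [hmem, Ne.symm n4])
    hd.1 (by simp [hmem, Ne.symm n3]) de.symm
  have s2 := Finset.insert_subset he.1 s1
  obtain ⟨cd', f3⟩ := step _ _ d c f2 s2 hd.2 (by simp [hmem, n13, Ne.symm n3])
    hc.1 (by simp [hmem, n11, Ne.symm n2]) cd.symm
  have s3 := Finset.insert_subset hd.1 s2
  obtain ⟨cc, f4⟩ := step _ _ c b f3 s3 hc.2 (by simp [hmem, n10, n11, Ne.symm n2])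
    hb.1 (by simp [hmem, n7, n8, Ne.symm n1]) bc.symm
  have s4 := Finset.insert_subset hc.1 s3
  obtain ⟨cb, f5⟩ := step _ _ b x f4 s4 hb.2 (by simp [hmem, n6, n7, n8, Ne.symm n1])
    hx.1 (by simp [hmem, Ne.symm n5, Ne.symm n12, Ne.symm n14, Ne.symm n15]) bx
  set g := Function.update (Function.update (Function.update (Function.update
    (Function.update f a ca) e ce) d cd') c cc) b cb with hg
  have hgb : g b = cb := by simp [hg]
  have hga : g a = ca := by simp [hg, n1, n2, n3, n4]
  have hg0 : ∀ v ∈ S0, g v = f v := by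
    intro v hv
    obtain ⟨-, h1, h2, h3, h4, h5, h6⟩ := (hmem v).1 hv
    simp [hg, h1, h2, h3, h4, h5]
  have hxmem : x ∉ insert b (insert c (insert d (insert e (insert a S0)))) := by
    simp [hmem, Ne.symm n5, Ne.symm n9, Ne.symm n12, Ne.symm n14, Ne.symm n15]
  have hall : insert x (insert b (insert c (insert d (insert e (insert a S0))))) = S := by
    ext v
    simp only [Finset.mem_insert, hmem]
    constructor
    · rintro (rfl | rfl | rfl | rfl | rfl | rfl | h)
      exacts [hx.1, hb.1, hc.1, hd.1, he.1, ha.1, h.1]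
    · intro h
      tauto
  have fin : ∀ y ∈ L x, y ∉ conflicts σ S0 f x → ca ≠ σ.sign a x * y → y ≠ σ.sign x b * cb →
      ∃ f, IsPartialColoring σ L S f := by
    intro y hyL hyc hya hyb
    have := f5.update hxmem hyL (by
      intro u hu hxu
      simp only [Finset.mem_insert] at hu
      rcases hu with rfl | rfl | rfl | rfl | rfl | hu
      · rwa [hgb]
      · exact absurd hxu hxc
      · exact absurd hxu hxd
      · exact absurd hxu hxe
      · rw [hga, Ne, σ.eq_sign_mul_iff]; exact hya
      · rw [hg0 u hu]; exact ne_of_notMem_conflicts hyc u hu hxu)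
    rw [hall] at this
    exact ⟨_, this⟩
  -- Of the neighbours of `x` coloured since `y1` and `y2` were fixed, only `b` can conflict, and
  -- with at most one of the two.
  by_cases h1 : y1 = σ.sign x b * cb
  · exact fin y2 hy2.1 hy2.2 hca'.2.2 (fun h2 => hy (h1.trans h2.symm))
  · exact fin y1 hy1.1 hy1.2 hca'.2.1 h1

/-- Each coincidence or adjacency would shortcut the 5-cycle through `x` to a 4-cycle sharing an
edge with the triangle `a b x`. -/
lemma LightPair.apex_ne_and_not_adj [Fintype V] [DecidableRel G.Adj] {a b c d e x : V}
    (h : LightPair G a b c d e x) (hG : G.NoTriangularFourCycle) :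
    (x ≠ c ∧ x ≠ d ∧ x ≠ e) ∧ ¬ G.Adj x c ∧ ¬ G.Adj x d ∧ ¬ G.Adj x e := by
  have hxc : x ≠ c := by
    rintro rfl
    exact hG a x d e b h.ax h.cd h.de h.ea h.da.symm h.ce h.ab h.bx.symm
  have hxd : x ≠ d := by
    rintro rfl
    exact hG a b c x x h.ab h.bc h.cd h.ax.symm h.ac h.bd h.ax h.bx
  have hxe : x ≠ e := by
    rintro rfl
    exact hG b x d c a h.bx h.de.symm h.cd.symm h.bc.symm h.bd h.ce.symm h.ab.symm h.ax.symm
  exact ⟨⟨hxc, hxd, hxe⟩,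
    fun hA => hG a b c x x h.ab h.bc hA.symm h.ax.symm h.ac h.bx.ne h.ax h.bx,
    fun hA => hG x b c d a h.bx.symm h.bc h.cd hA.symm hxc h.bd h.ax.symm h.ab.symm,
    fun hA => hG b a e x x h.ab.symm h.ea.symm hA.symm h.bx.symm h.eb.symm h.ax.ne h.bx h.ax⟩

open Classical in
lemma degree_induce_eq (S : Finset V) (v : (S : Set V))
    [Fintype ((G.induce (S : Set V)).neighborSet v)] :
    (G.induce (S : Set V)).degree v = (S.filter (G.Adj v)).card := by
  rw [← SimpleGraph.card_neighborFinset_eq_degree]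
  refine Finset.card_bij (fun u _ => u.1) ?_ (fun u _ w _ h => Subtype.ext h) ?_
  · intro u hu
    rw [SimpleGraph.mem_neighborFinset] at hu
    exact Finset.mem_filter.2 ⟨u.2, hu⟩
  · intro u hu
    obtain ⟨h1, h2⟩ := Finset.mem_filter.1 hu
    exact ⟨⟨u, h1⟩, by rw [SimpleGraph.mem_neighborFinset]; exact h2, rfl⟩

open Classical in
theorem IsPlanar.exists_isPartialColoring [Fintype V] (hpl : IsPlanar G)
    (hG : G.NoTriangularFourCycle) (hL : ∀ v, (L v).card = 4) (S : Finset V) :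
    ∃ f, IsPartialColoring σ L S f := by
  induction S using Finset.strongInduction with
  | H S ih =>
    rcases S.eq_empty_or_nonempty with rfl | hne
    · exact ⟨fun _ => 0, by simp [IsPartialColoring]⟩
    by_cases hmin : ∃ v ∈ S, (S.filter (G.Adj v)).card ≤ 3
    · obtain ⟨v, hv, h3⟩ := hmin
      obtain ⟨f, hf⟩ := ih (S.erase v) (Finset.erase_ssubset hv)
      obtain ⟨c, hc⟩ := hf.exists_insert (Finset.notMem_erase v S) (by
        rw [hL]
        exact (Finset.card_le_card (Finset.filter_subset_filter _ (Finset.erase_subset v S))).trans_lt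
          (by omega))
      rw [Finset.insert_erase hv] at hc
      exact ⟨_, hc⟩
    push Not at hmin
    have : Nonempty (S : Set V) := hne.to_subtype
    -- Degrees and non-adjacencies are those of the graph induced on `S`, which is all the extension
    -- step requires.
    obtain ⟨a, b, c, d, e, x, h⟩ := (hpl.induce (S : Set V)).exists_lightPair (hG.induce _)
      (fun v => by rw [degree_induce_eq]; exact hmin v v.2)
    obtain ⟨⟨xc, xd, xe⟩, hxc, hxd, hxe⟩ := h.apex_ne_and_not_adj (hG.induce _)
    have hdeg : ∀ v ∈ ({a.1, b.1, c.1, d.1, e.1, x.1} : Finset V),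
        v ∈ S ∧ (S.filter (G.Adj v)).card ≤ 4 := by
      intro v hv
      simp only [Finset.mem_insert, Finset.mem_singleton] at hv
      rcases hv with rfl | rfl | rfl | rfl | rfl | rfl
      · exact ⟨a.2, ((degree_induce_eq S a).symm.trans h.deg_a).le⟩
      · exact ⟨b.2, ((degree_induce_eq S b).symm.trans h.deg_b).le⟩
      · exact ⟨c.2, ((degree_induce_eq S c).symm.trans h.deg_c).le⟩
      · exact ⟨d.2, ((degree_induce_eq S d).symm.trans h.deg_d).le⟩
      · exact ⟨e.2, ((degree_induce_eq S e).symm.trans h.deg_e).le⟩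
      · exact ⟨x.2, ((degree_induce_eq S x).symm.trans h.deg_x).le⟩
    have hdis : [a.1, b.1, c.1, d.1, e.1, x.1].Nodup := by
      have : [a, b, c, d, e, x].Nodup := by
        simp only [List.nodup_cons, List.mem_cons, List.not_mem_nil, or_false, not_or,
          not_false_eq_true, List.nodup_nil, and_true]
        exact ⟨⟨h.ab.ne, h.ac, h.da.symm, h.ea.ne.symm, h.ax.ne⟩,
          ⟨h.bc.ne, h.bd, h.eb.symm, h.bx.ne⟩, ⟨h.cd.ne, h.ce, xc.symm⟩, ⟨h.de.ne, xd.symm⟩,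
          xe.symm⟩
      exact this.map Subtype.val_injective
    obtain ⟨f, hf⟩ := ih (S \ {a.1, b.1, c.1, d.1, e.1, x.1})
      (Finset.sdiff_ssubset (fun v hv => (hdeg v hv).1) ⟨a.1, by simp⟩)
    exact hf.exists_extend hL hdeg hdis h.ab h.bc h.cd h.de h.ea h.ax h.bx hxc hxd hxe

end Coloring

theorem mainTheorem2 {V : Type*} [Finite V] (G : SimpleGraph V) (hplanar : IsPlanar G)
    (hcycles : NoFourCycleAdjacentToTriangle G) : IsSignedChoosable G 4 := by
  intro σ L hL
  have := Fintype.ofFinite V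
  -- Possibly infinite lists are trimmed to four colours, so that conflicts can be counted in finite
  -- sets.
  have hex : ∀ v, ∃ T : Finset ℤ, (T : Set ℤ) ⊆ L v ∧ T.card = 4 := by
    intro v
    obtain ⟨t, ht, htc⟩ := Set.exists_subset_encard_eq (hL v)
    have hfin : t.Finite := Set.finite_of_encard_eq_coe htc
    refine ⟨hfin.toFinset, by simpa using ht, ?_⟩
    rw [hfin.encard_eq_coe_toFinset_card] at htc
    exact_mod_cast htc
  choose L' hL' hcard using hex
  obtain ⟨f, hf1, hf2⟩ := hplanar.exists_isPartialColoring (σ := σ)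
    hcycles.noTriangularFourCycle hcard Finset.univ
  refine ⟨f, fun v => hL' v (hf1 v (Finset.mem_univ v)), fun u v h => ?_⟩
  have := hf2 u (Finset.mem_univ u) v (Finset.mem_univ v) h
  rwa [Signature.sign, dif_pos h] at this
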